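/- **Theorem (Minimax lower bound).** Let $d\ge 1$, $\Omega=[0,1]^d$, $\beta>0$, $C_\beta>0$, $\sigma>0$, $0<\mu_{\min}<1<\mu_{\max}<\infty$, and let $\underline c,\bar c\in[0,1]$ with $\underline c+\bar c>0$. Let $\|\cdot\|$ be the Euclidean norm and $\lfloor\beta\rfloor$ the greatest integer strictly less than $\beta$. *Distributions.* $\mathcal P(\beta)$ is the set of laws of random pairs $(X,Y)\in\mathbb R^d\times\mathbb R$ such that: the law of $X$ has a density $\mu$ with respect to Lebesgue measure on $\Omega$ with $\mu_{\min}<\mu(x)<\mu_{\max}$ for all $x\in\Omega$; $Y$ is integrable and $\mathbb E(Y\mid X)=f(X)$ a.s., where $f:\Omega\to\mathbb R$ has continuous partial derivatives up to order $\lfloor\beta\rfloor$ and $$\max_{0\le|s|\le\lfloor\beta\rfloor}\sup_{x\in\Omega}|D^sf(x)|+\max_{|s|=\lfloor\beta\rfloor}\sup_{x,z\in\Omega,\,x\ne z}\frac{|D^sf(x)-D^sf(z)|}{\|x-z\|^{\beta-\lfloor\beta\rfloor}}\le C_\beta;$$ and $\xi=Y-f(X)$ satisfies $\mathbb E[e^{t\xi}\mid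 X]\le e^{t^2\sigma^2/2}$ a.s. for every $t\in\mathbb R$. *Attacks.* For $r\ge 0$, $\mathcal T(r)$ is the set of maps $A$ that assign to each $x\in\Omega$ a measurable set $A(x)$ with $x\in A(x)\subseteq\Omega$, such that $\sup_{x\in\Omega,\,x'\in A(x)}\|x'-x\|=r$ and, for some unit vector $v\in\mathbb R^d$, the following holds for every $x\in\Omega$: if $k_{\min}(x)\le 0\le k_{\max}(x)$ are defined by $\{kv+x:k_{\min}(x)\le k\le k_{\max}(x)\}=\{kv+x:k\in\mathbb R\}\cap\Omega$, then $$\{kv+x:\ k_{\min}(x)\vee(-\underline c r)\le k\le k_{\max}(x)\wedge(\bar c r)\}=\{kv+x:\ k_{\min}(x)\le k\le k_{\max}(x)\}\cap A(x).$$ *Risks.* Let $Z_n=\{(X_1,Y_1),\dots,(X_n,Y_n)\}$ be i.i.d. copies of $(X,Y)$, independent of $(X,Y)$. An estimator is a measurable map $\hat f(x)=\hat f(x,Z_n)$ of $(x,Z_n)$ with real values. Put $$R_{A,q}(\hat f,f)=\mathbb E\sup_{x'\in A(X)}|\hat f(x')-f(X)|^q\quad(1\le q<\infty),\qquad R_{A,\infty}(\hat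 f,f)=\mathbb E\sup_{x\in\Omega}\sup_{x'\in A(x)}|\hat f(x')-f(x)|,$$ the expectation being over $(X,Y)$ and $Z_n$ in the first case and over $Z_n$ in the second (and understood as a lower integral if the supremum is not measurable). *Claim.* For every $1\le q\le\infty$ there are $c>0$ and $N\in\mathbb N$, depending only on $d,\beta,C_\beta,\mu_{\min},\mu_{\max},\sigma,\underline c,\bar c,q$, such that for all $n\ge N$, all $r$ and all $A\in\mathcal T(r)$, $$\inf_{\hat f}\ \sup_{\mathbb P_{(X,Y)}\in\mathcal P(\beta)}R_{A,q}(\hat f,f)\ \ge\ \begin{cases}c\left(r^{q(1\wedge\beta)}+n^{-\frac{q\beta}{2\beta+d}}\right),&1\le q<\infty,\\[4pt] c\left(r^{1\wedge\beta}+\left(\frac{n}{\log n}\right)^{-\frac{\beta}{2\beta+d}}\right),&q=\infty,\end{cases}$$ where the infimum is over all measurable estimators. -/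

import Mathlib

open MeasureTheory ProbabilityTheory Set
open scoped ENNReal

namespace AdvReg

/-- The Euclidean space `ℝ^d`. -/
abbrev E (d : ℕ) : Type := EuclideanSpace ℝ (Fin d)

/-- The unit cube `Ω = [0,1]^d`. -/
def cube (d : ℕ) : Set (E d) := {x | ∀ i, x i ∈ Icc (0 : ℝ) 1}

/-- The greatest integer strictly less than `β` (used for `β > 0` only). -/
noncomputable def sfloor (β : ℝ) : ℕ := ⌈β⌉₊ - 1

/-- The partial derivative `D^s f (x)` on the cube for a multi-index `s`: the derivative of order
`|s|` of `f` within the cube, evaluated at the list of basis vectors in which `e_i` occurs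
`s i` times. -/
noncomputable def partialD {d : ℕ} (s : Fin d → ℕ) (f : E d → ℝ) (x : E d) : ℝ :=
  iteratedFDerivWithin ℝ (∑ i, s i) f (cube d) x
    (fun j => EuclideanSpace.single (finSigmaFinEquiv.symm j).1 (1 : ℝ))

/-- The Hölder norm of order `β` on the cube, with values in `[0,∞]`. -/
noncomputable def holderNorm {d : ℕ} (β : ℝ) (f : E d → ℝ) : ℝ≥0∞ :=
  (⨆ (s : Fin d → ℕ) (_ : ∑ i, s i ≤ sfloor β) (x ∈ cube d), ENNReal.ofReal |partialD s f x|) +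
  (⨆ (s : Fin d → ℕ) (_ : ∑ i, s i = sfloor β) (x ∈ cube d) (z ∈ cube d),
    ENNReal.ofReal (|partialD s f x - partialD s f z| / ‖x - z‖ ^ (β - (sfloor β : ℝ))))

/-- The Hölder class `ℱ(β, C)`. Only the values of `f` on the cube matter. -/
def HolderClass (d : ℕ) (β C : ℝ) : Set (E d → ℝ) :=
  {f | ContDiffOn ℝ (sfloor β : ℕ) f (cube d) ∧ holderNorm β f ≤ ENNReal.ofReal C}

/-- The bounded density condition on the law of `X`: a density with respect to Lebesgue measure
on the cube which lies strictly between `μmin` and `μmax` everywhere on the cube. -/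
def BoundedDensity {d : ℕ} (μmin μmax : ℝ) (PX : Measure (E d)) : Prop :=
  ∃ μ : E d → ℝ, Measurable μ ∧ (∀ x ∈ cube d, μmin < μ x ∧ μ x < μmax) ∧
    PX = (volume.restrict (cube d)).withDensity (fun x => ENNReal.ofReal (μ x))

/-- The sigma-algebra on `ℝ^d × ℝ` generated by the covariate `X` (the first coordinate). -/
abbrev sigmaX (d : ℕ) : MeasurableSpace (E d × ℝ) :=
  MeasurableSpace.comap Prod.fst inferInstance

/-- The law `P` of `(X, Y)` belongs to the nonparametric class `𝒫(β, C, μmin, μmax, σ)` and `f` is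
its regression function: `E(Y | X) = f(X)` with `f` in the Hölder class, the law of `X` has a
bounded density, and the error `ξ = Y - f(X)` is conditionally sub-Gaussian given `X`. -/
structure InClass {d : ℕ} (β C μmin μmax σ : ℝ) (P : Measure (E d × ℝ)) (f : E d → ℝ) :
    Prop where
  prob : IsProbabilityMeasure P
  holder : f ∈ HolderClass d β C
  density : BoundedDensity μmin μmax (P.map Prod.fst)
  integrable_snd : Integrable (fun w : E d × ℝ => w.2) P
  regression : P[fun w : E d × ℝ => w.2 | sigmaX d] =ᵐ[P] fun w => f w.1
  integrable_exp : ∀ t : ℝ, Integrable (fun w : E d × ℝ => Real.exp (t * (w.2 - f w.1))) P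
  subgaussian : ∀ t : ℝ,
    P[fun w : E d × ℝ => Real.exp (t * (w.2 - f w.1)) | sigmaX d] ≤ᵐ[P]
      fun _ => Real.exp (t ^ 2 * σ ^ 2 / 2)

/-- An `X`-attack assigns to every point of the cube a measurable set of perturbed inputs, which
contains the point and is contained in the cube; its magnitude is `r`. -/
structure IsAttack {d : ℕ} (A : E d → Set (E d)) (r : ℝ) : Prop where
  measurable : ∀ x ∈ cube d, MeasurableSet (A x)
  mem_self : ∀ x ∈ cube d, x ∈ A x
  subset : ∀ x ∈ cube d, A x ⊆ cube d
  magnitude : IsLUB {t : ℝ | ∃ x ∈ cube d, ∃ x' ∈ A x, t = ‖x' - x‖} r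

/-- `(v, r)`-SODA with constants `cl` (lower) and `cu` (upper). -/
structure IsSODA {d : ℕ} (cl cu : ℝ) (v : E d) (r : ℝ) (A : E d → Set (E d)) : Prop where
  attack : IsAttack A r
  unit : ‖v‖ = 1
  segment : ∀ x ∈ cube d, ∃ kmin kmax kmin' kmax' : ℝ,
    kmin ≤ 0 ∧ 0 ≤ kmax ∧
    (fun k : ℝ => k • v + x) '' Icc kmin kmax = range (fun k : ℝ => k • v + x) ∩ cube d ∧
    (fun k : ℝ => k • v + x) '' Icc kmin' kmax' =
      ((fun k : ℝ => k • v + x) '' Icc kmin kmax) ∩ A x ∧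
    kmin' = max kmin (-(cl * r)) ∧ kmax' = min kmax (cu * r)

/-- The class `𝒯(r)` of all SODAs of magnitude `r`, for given constants `cl`, `cu`. -/
def SODAClass (d : ℕ) (cl cu r : ℝ) : Set (E d → Set (E d)) :=
  {A | ∃ v : E d, IsSODA cl cu v r A}

/-- A sample of size `n`. -/
abbrev Sample (d n : ℕ) : Type := Fin n → E d × ℝ

/-- Adversarial `L_q`-risk, `1 ≤ q < ∞`: the expectation is with respect to the product of the
law of a fresh pair `(X, Y)` and the law of the i.i.d. sample. -/
noncomputable def advRisk {d n : ℕ} (q : ℝ) (A : E d → Set (E d)) (P : Measure (E d × ℝ))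
    (fhat : Sample d n → E d → ℝ) (f : E d → ℝ) : ℝ≥0∞ :=
  ∫⁻ w : (E d × ℝ) × Sample d n,
    ⨆ x' ∈ A w.1.1, ENNReal.ofReal (|fhat w.2 x' - f w.1.1| ^ q)
    ∂(P.prod (Measure.pi fun _ : Fin n => P))

/-- Adversarial sup-norm risk (`q = ∞`). -/
noncomputable def advRiskSup {d n : ℕ} (A : E d → Set (E d)) (P : Measure (E d × ℝ))
    (fhat : Sample d n → E d → ℝ) (f : E d → ℝ) : ℝ≥0∞ :=
  ∫⁻ z : Sample d n,
    ⨆ x ∈ cube d, ⨆ x' ∈ A x, ENNReal.ofReal |fhat z x' - f x|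
    ∂(Measure.pi fun _ : Fin n => P)

/-- Adversarial minimax `L_q`-risk, `1 ≤ q < ∞`: infimum over all measurable estimators, supremum
over the distribution class. -/
noncomputable def minimaxRisk {d : ℕ} (n : ℕ) (β C μmin μmax σ q : ℝ) (A : E d → Set (E d)) :
    ℝ≥0∞ :=
  ⨅ (fhat : Sample d n → E d → ℝ) (_ : Measurable (Function.uncurry fhat)),
    ⨆ (P : Measure (E d × ℝ)) (f : E d → ℝ) (_ : InClass β C μmin μmax σ P f),
      advRisk q A P fhat f

/-- Adversarial minimax sup-norm risk. -/
noncomputable def minimaxRiskSup {d : ℕ} (n : ℕ) (β C μmin μmax σ : ℝ) (A : E d → Set (E d)) :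
    ℝ≥0∞ :=
  ⨅ (fhat : Sample d n → E d → ℝ) (_ : Measurable (Function.uncurry fhat)),
    ⨆ (P : Measure (E d × ℝ)) (f : E d → ℝ) (_ : InClass β C μmin μmax σ P f),
      advRiskSup A P fhat f

end AdvReg

namespace AdvReg

/-! The right-hand side has two terms. Each is bounded below on its own by restricting the supremum
to a small subfamily, and half the minimum of the two constants then serves for the sum. All
subfamilies live in one model: `X` is uniform on the cube and `Y = ±σ` with conditional mean `f X`,
where `|f| ≤ σ`. Hoeffding's lemma makes the noise sub-Gaussian with the required constant
(`inClass_law`), and when `f * g = 0` the likelihood ratio between `f + g` and `f` is the explicit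
function `1 + y g(x) / σ²` (`law_add`), so second moments of likelihood ratios reduce to integrals
of products of functions.

The term in `n` is the classical nonparametric rate, which persists because `x ∈ A x`. The cube is
cut into `m ^ d` cells carrying disjoint bumps of height about `m ^ (-β)`, with `m` about `n ^ (1 /
(2β + d))`. A single bump then changes the law of the sample by a bounded amount. For finite `q`,
the two-point bound is applied to each cell and averaged over all sets of bumps (`assouad_humps`).
For the uniform norm, `n` is replaced by `n / log n` and the zero function is tested against the
uniform mixture of single bumps (`mixture_humps`): there are enough cells to hide a bump that is
larger by a logarithmic factor.

The term in `r` involves no statistics and holds for every `n`. The attack may move `x` to `x + δu`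
for a fixed unit vector `u` and `δ` proportional to `r`. The value of the estimator at `x + δu` is
thus compared both with `f (x + δu)` and with `f x`, so some error is at least half the increment of
`f`. Plane waves in direction `u` have increments of order `δ ^ min 1 β`, and two phases a quarter
period apart ensure that this is so at every point (`wave_increment`).

For finite `q`, both terms are proved for the integrated first power, and Jensen's inequality passes
to the power `q` (`lintegral_rpow_le_advRisk`). Since the supremum over `A x` need not be
measurable, only measurable minorants of it are integrated. -/

/-! ### The cube and rescaled smooth functions in the Hölder class -/

theorem natCast_le_infty (j : ℕ) : (j : WithTop ℕ∞) ≤ ((⊤ : ℕ∞) : WithTop ℕ∞) := by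
  exact_mod_cast le_top

theorem sfloor_lt {β : ℝ} (hβ : 0 < β) : (sfloor β : ℝ) < β := by
  have h1 : 0 < ⌈β⌉₊ := Nat.ceil_pos.2 hβ
  have h2 : ((⌈β⌉₊ - 1 : ℕ) : ℝ) = (⌈β⌉₊ : ℝ) - 1 := by
    rw [Nat.cast_sub h1]; simp
  have h3 := Nat.ceil_lt_add_one hβ.le
  unfold sfloor
  rw [h2]; linarith

theorem le_sfloor_add_one (β : ℝ) : β ≤ (sfloor β : ℝ) + 1 := by
  have h2 : ⌈β⌉₊ ≤ ⌈β⌉₊ - 1 + 1 := by omega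
  have h3 := Nat.le_ceil β
  have h4 : (⌈β⌉₊ : ℝ) ≤ ((⌈β⌉₊ - 1 + 1 : ℕ) : ℝ) := by exact_mod_cast h2
  unfold sfloor
  push_cast at h4; linarith

theorem convex_cube (d : ℕ) : Convex ℝ (cube d) := by
  intro x hx y hy a b ha hb hab i
  have := (convex_Icc (0 : ℝ) 1) (hx i) (hy i) ha hb hab
  simpa using this

theorem ball_subset_cube {d : ℕ} {c : E d} {ρ : ℝ} (hc : ∀ i, ρ ≤ c i ∧ c i ≤ 1 - ρ) :
    Metric.closedBall c ρ ⊆ cube d := by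
  intro x hx i
  have h1 : |x i - c i| ≤ ρ := by
    have := PiLp.norm_apply_le (x - c) i
    rw [Metric.mem_closedBall, dist_eq_norm] at hx
    simpa using this.trans hx
  have := abs_le.1 h1
  have := hc i
  constructor <;> linarith

/-- The cube is convex with nonempty interior. Hence derivatives within the cube of a globally
smooth function are its ordinary derivatives. -/
theorem uniqueDiffOn_cube (d : ℕ) : UniqueDiffOn ℝ (cube d) := by
  apply uniqueDiffOn_convex (convex_cube d)
  let c : E d := WithLp.toLp 2 (fun _ => (1 / 2 : ℝ))
  refine ⟨c, mem_interior_iff_mem_nhds.2 ?_⟩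
  refine Filter.mem_of_superset (Metric.closedBall_mem_nhds c (ε := 1 / 4) (by norm_num)) ?_
  apply ball_subset_cube
  intro i
  simp only [c]
  norm_num

theorem measurableSet_cube (d : ℕ) : MeasurableSet (cube d) := by
  have : cube d = ⋂ i, (fun x : E d => x i) ⁻¹' Icc 0 1 := by
    ext x; simp [cube]
  rw [this]
  exact MeasurableSet.iInter fun i => (by fun_prop : Measurable fun x : E d => x i) measurableSet_Icc

theorem volume_cube (d : ℕ) : volume (cube d) = 1 := by
  have h : (cube d) = (WithLp.ofLp : E d → (Fin d → ℝ)) ⁻¹' (Set.pi univ fun _ => Icc (0 : ℝ) 1) := by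
    ext x; simp [cube, Pi.le_def, forall_and]
  rw [h, (PiLp.volume_preserving_ofLp (Fin d)).measure_preimage
    (MeasurableSet.univ_pi fun _ => measurableSet_Icc).nullMeasurableSet, volume_pi_pi]
  simp

theorem abs_apply_single_le {d k : ℕ} (m : (E d) [×k]→L[ℝ] ℝ) (g : Fin k → Fin d) :
    |m (fun j => EuclideanSpace.single (g j) (1 : ℝ))| ≤ ‖m‖ := by
  have := m.le_opNorm (fun j => EuclideanSpace.single (g j) (1 : ℝ))
  simpa using this

/-- A rescaled copy at scale `h` of a smooth function with bounded derivatives, of amplitude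
`L * h ^ β`, has controlled derivatives. -/
theorem norm_iteratedFDeriv_rescale_le {d : ℕ} {Φ : E d → ℝ} (hΦ : ContDiff ℝ ((⊤ : ℕ∞) : WithTop ℕ∞) Φ) {K L h β : ℝ}
    (hL : 0 ≤ L) (hh : 0 < h) {j : ℕ} (hK : ∀ y, ‖iteratedFDeriv ℝ j Φ y‖ ≤ K) (x : E d) :
    ‖iteratedFDeriv ℝ j (fun x => L * h ^ β * Φ (h⁻¹ • x)) x‖ ≤ L * K * h ^ (β - j) := by
  let g : E d →L[ℝ] E d := h⁻¹ • ContinuousLinearMap.id ℝ (E d)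
  have hg : ‖g‖ ≤ h⁻¹ := by
    refine (norm_smul_le (h⁻¹) (ContinuousLinearMap.id ℝ (E d))).trans ?_
    rw [Real.norm_of_nonneg (inv_nonneg.2 hh.le)]
    exact mul_le_of_le_one_right (inv_nonneg.2 hh.le) ContinuousLinearMap.norm_id_le
  have hfun : (fun x => L * h ^ β * Φ (h⁻¹ • x)) = (L * h ^ β) • (Φ ∘ g) := by
    ext x; simp [g]
  have hcd : ContDiff ℝ ((⊤ : ℕ∞) : WithTop ℕ∞) (Φ ∘ g) := hΦ.comp g.contDiff
  have hLh : 0 ≤ L * h ^ β := mul_nonneg hL (Real.rpow_nonneg hh.le _)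
  have hK0 : 0 ≤ K := (norm_nonneg _).trans (hK 0)
  rw [hfun, iteratedFDeriv_const_smul_apply ((hcd.of_le (natCast_le_infty _)).contDiffAt), norm_smul,
    Real.norm_of_nonneg hLh,
    g.iteratedFDeriv_comp_right hΦ x (i := j) (natCast_le_infty _)]
  have h1 := ContinuousMultilinearMap.norm_compContinuousLinearMap_le
    (iteratedFDeriv ℝ j Φ (g x)) (fun _ : Fin j => g)
  have h2 : ∏ _i : Fin j, ‖g‖ ≤ (h⁻¹) ^ j := by
    simpa using pow_le_pow_left₀ (norm_nonneg _) hg j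
  calc L * h ^ β * _ ≤ L * h ^ β * (K * (h⁻¹) ^ j) := by
        refine mul_le_mul_of_nonneg_left (h1.trans ?_) hLh
        exact mul_le_mul (hK _) h2 (by positivity) hK0
    _ = L * K * h ^ (β - j) := by
        rw [Real.rpow_sub hh, Real.rpow_natCast, inv_pow]; ring

/-- Interpolation at the scale `h`. Points at distance at least `h` are handled by the size of the
derivative of order `sfloor β`, closer points by the mean value inequality and the derivative of one
order more. The factor 3 adds the contribution 1 of the sup norms to the contribution 2 of the
Hölder seminorm. -/
theorem mem_holderClass_rescale {d : ℕ} {Φ : E d → ℝ} (hΦ : ContDiff ℝ ((⊤ : ℕ∞) : WithTop ℕ∞) Φ) {K L h β C : ℝ}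
    (hβ : 0 < β) (hL : 0 ≤ L) (hh : 0 < h) (hh1 : h ≤ 1)
    (hK : ∀ j ≤ sfloor β + 1, ∀ y, ‖iteratedFDeriv ℝ j Φ y‖ ≤ K) (hC : 3 * (L * K) ≤ C) :
    (fun x => L * h ^ β * Φ (h⁻¹ • x)) ∈ HolderClass d β C := by
  set f : E d → ℝ := fun x => L * h ^ β * Φ (h⁻¹ • x) with hf
  have hfs : ContDiff ℝ ((⊤ : ℕ∞) : WithTop ℕ∞) f := by
    have : ContDiff ℝ ((⊤ : ℕ∞) : WithTop ℕ∞) (fun x : E d => h⁻¹ • x) := contDiff_const_smul _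
    exact contDiff_const.mul (hΦ.comp this)
  have hK0 : 0 ≤ K := (norm_nonneg _).trans (hK 0 (by omega) 0)
  have hLK : 0 ≤ L * K := mul_nonneg hL hK0
  have hb : ∀ j ≤ sfloor β + 1, ∀ x, ‖iteratedFDeriv ℝ j f x‖ ≤ L * K * h ^ (β - j) :=
    fun j hj x => norm_iteratedFDeriv_rescale_le hΦ hL hh (hK j hj) x
  have hwithin : ∀ (j : ℕ), ∀ x ∈ cube d,
      iteratedFDerivWithin ℝ j f (cube d) x = iteratedFDeriv ℝ j f x := fun j x hx =>
    iteratedFDerivWithin_eq_iteratedFDeriv (uniqueDiffOn_cube d) ((hfs.of_le (natCast_le_infty _)).contDiffAt) hx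
  have hlt := sfloor_lt hβ
  have hle := le_sfloor_add_one β
  set α : ℝ := β - (sfloor β : ℝ) with hα
  have hα0 : 0 < α := by linarith
  have hα1 : α ≤ 1 := by linarith
  refine ⟨(hfs.of_le (natCast_le_infty _)).contDiffOn, ?_⟩
  have h1 : (⨆ (s : Fin d → ℕ) (_ : ∑ i, s i ≤ sfloor β) (x ∈ cube d),
      ENNReal.ofReal |partialD s f x|) ≤ ENNReal.ofReal (L * K) := by
    refine iSup_le fun s => iSup_le fun hs => iSup_le fun x => iSup_le fun hx => ?_
    refine ENNReal.ofReal_le_ofReal ?_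
    unfold partialD
    rw [hwithin _ x hx]
    refine (abs_apply_single_le _ _).trans ((hb _ (by omega) x).trans ?_)
    refine mul_le_of_le_one_right hLK (Real.rpow_le_one hh.le hh1 ?_)
    have : ((∑ i, s i : ℕ) : ℝ) ≤ sfloor β := by exact_mod_cast hs
    linarith
  have key : ∀ x z, ‖iteratedFDeriv ℝ (sfloor β) f x - iteratedFDeriv ℝ (sfloor β) f z‖ ≤
      2 * (L * K) * ‖x - z‖ ^ α := by
    intro x z
    have e1 : ‖iteratedFDeriv ℝ (sfloor β) f x - iteratedFDeriv ℝ (sfloor β) f z‖ ≤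
        2 * (L * K) * h ^ α := by
      refine (norm_sub_le _ _).trans ?_
      have a1 := hb (sfloor β) (by omega) x
      have a2 := hb (sfloor β) (by omega) z
      linarith
    have e2 : ‖iteratedFDeriv ℝ (sfloor β) f x - iteratedFDeriv ℝ (sfloor β) f z‖ ≤
        L * K * h ^ (α - 1) * ‖x - z‖ := by
      refine (convex_univ (𝕜 := ℝ) (E := E d)).norm_image_sub_le_of_norm_fderiv_le
        (𝕜 := ℝ) (f := iteratedFDeriv ℝ (sfloor β) f)
        (fun y _ => ?_) (fun y _ => ?_) (mem_univ z) (mem_univ x)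
      · exact (hfs.differentiable_iteratedFDeriv (by exact_mod_cast ENat.natCast_lt_top _)) y
      · rw [norm_fderiv_iteratedFDeriv]
        refine (hb (sfloor β + 1) le_rfl y).trans (le_of_eq ?_)
        push_cast
        rw [show β - ((sfloor β : ℝ) + 1) = α - 1 by rw [hα]; ring]
    have hxz := norm_nonneg (x - z)
    rcases le_total h ‖x - z‖ with hc | hc
    · exact e1.trans (mul_le_mul_of_nonneg_left (Real.rpow_le_rpow hh.le hc hα0.le) (by linarith))
    · rcases hxz.eq_or_lt with h0 | h0
      · rw [← h0] at e2 ⊢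
        simpa [Real.zero_rpow hα0.ne'] using e2
      refine e2.trans ?_
      have : h ^ (α - 1) * ‖x - z‖ ≤ ‖x - z‖ ^ α := by
        have e3 : ‖x - z‖ ^ α = ‖x - z‖ ^ (α - 1) * ‖x - z‖ := by
          rw [← Real.rpow_add_one h0.ne', sub_add_cancel]
        rw [e3]
        exact mul_le_mul_of_nonneg_right
          (Real.rpow_le_rpow_of_nonpos h0 hc (by linarith)) hxz
      calc L * K * h ^ (α - 1) * ‖x - z‖ = L * K * (h ^ (α - 1) * ‖x - z‖) := by ring
        _ ≤ L * K * ‖x - z‖ ^ α := mul_le_mul_of_nonneg_left this hLK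
        _ ≤ 2 * (L * K) * ‖x - z‖ ^ α := by
          have := mul_nonneg hLK (Real.rpow_nonneg hxz α)
          linarith
  have h2 : (⨆ (s : Fin d → ℕ) (_ : ∑ i, s i = sfloor β) (x ∈ cube d) (z ∈ cube d),
      ENNReal.ofReal (|partialD s f x - partialD s f z| / ‖x - z‖ ^ (β - (sfloor β : ℝ)))) ≤
      ENNReal.ofReal (2 * (L * K)) := by
    refine iSup_le fun s => iSup_le fun hs => iSup_le fun x => iSup_le fun hx =>
      iSup_le fun z => iSup_le fun hz => ?_
    refine ENNReal.ofReal_le_ofReal ?_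
    -- The supremum also runs over `x = z`, where the quotient is zero by convention; this form of
    -- the inequality covers a vanishing denominator.
    refine div_le_of_le_mul₀ (Real.rpow_nonneg (norm_nonneg _) _) (by linarith) ?_
    unfold partialD
    rw [hwithin _ x hx, hwithin _ z hz, ← sub_apply]
    refine (abs_apply_single_le _ _).trans ?_
    have := key x z
    rw [← hs] at this
    exact this
  calc holderNorm β f ≤ ENNReal.ofReal (L * K) + ENNReal.ofReal (2 * (L * K)) := add_le_add h1 h2
    _ = ENNReal.ofReal (3 * (L * K)) := by
      rw [← ENNReal.ofReal_add hLK (by linarith)]; ring_nf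
    _ ≤ _ := ENNReal.ofReal_le_ofReal hC

theorem norm_iteratedFDeriv_sin_inner_le {d : ℕ} {v : E d} (hv : ‖v‖ ≤ 1) (θ : ℝ) (j : ℕ) (y : E d) :
    ‖iteratedFDeriv ℝ j (fun y => Real.sin (inner ℝ v y + θ)) y‖ ≤ 1 := by
  have hs : ContDiff ℝ ((⊤ : ℕ∞) : WithTop ℕ∞) (fun t : ℝ => Real.sin (t + θ)) := by fun_prop
  have : (fun y => Real.sin (inner ℝ v y + θ)) =
      (fun t : ℝ => Real.sin (t + θ)) ∘ (innerSL ℝ v) := by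
    ext y; simp
  rw [this, (innerSL ℝ v).iteratedFDeriv_comp_right hs y (i := j) (natCast_le_infty _)]
  refine (ContinuousMultilinearMap.norm_compContinuousLinearMap_le _ _).trans ?_
  rw [norm_iteratedFDeriv_eq_norm_iteratedDeriv, iteratedDeriv_comp_add_const]
  refine mul_le_one₀ (Real.abs_iteratedDeriv_sin_le_one _ _)
    (Finset.prod_nonneg fun _ _ => norm_nonneg _) ?_
  simpa using pow_le_one₀ (norm_nonneg v) hv

/-! ### Disjoint bumps on a regular partition of the cube -/

/-- A smooth bump at the origin: equal to one on the ball of radius `1/4` and supported in the ball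
of radius `1/3`. -/
noncomputable def stdBump (d : ℕ) : ContDiffBump (0 : E d) where
  rIn := 1 / 4
  rOut := 1 / 3
  rIn_pos := by norm_num
  rIn_lt_rOut := by norm_num

/-- The centre of the unit lattice cell with index `k`. -/
noncomputable def latticeCenter {d m : ℕ} (k : Fin d → Fin m) : E d :=
  WithLp.toLp 2 fun i => (k i : ℝ) + 1 / 2

/-- Distinct centres differ by at least 1 in some coordinate, while two balls of radius `1/3`
sharing a point have centres within `2/3` of each other. -/
theorem eq_of_mem_closedBall_latticeCenter {d m : ℕ} {k l : Fin d → Fin m} {y : E d}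
    (hk : y ∈ Metric.closedBall (latticeCenter k) (1 / 3))
    (hl : y ∈ Metric.closedBall (latticeCenter l) (1 / 3)) : k = l := by
  funext i
  rw [Metric.mem_closedBall, dist_eq_norm] at hk hl
  have h1 := (PiLp.norm_apply_le (y - latticeCenter k) i).trans hk
  have h2 := (PiLp.norm_apply_le (y - latticeCenter l) i).trans hl
  simp only [latticeCenter, PiLp.sub_apply, Real.norm_eq_abs] at h1 h2
  have h1' := abs_le.1 h1
  have h2' := abs_le.1 h2
  have h3 : ((k i : ℕ) : ℝ) < (l i : ℕ) + 1 := by linarith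
  have h4 : ((l i : ℕ) : ℝ) < (k i : ℕ) + 1 := by linarith
  have h5 : (k i : ℕ) < (l i : ℕ) + 1 := by exact_mod_cast h3
  have h6 : (l i : ℕ) < (k i : ℕ) + 1 := by exact_mod_cast h4
  exact Fin.ext (by omega)

theorem stdBump_sub_eq_zero {d : ℕ} {c y : E d} (h : y ∉ Metric.closedBall c (1 / 3)) :
    stdBump d (y - c) = 0 := by
  apply (stdBump d).zero_of_le_dist
  rw [Metric.mem_closedBall, not_le, dist_eq_norm] at h
  rw [dist_zero_right]
  exact h.le

/-- A sum of unit bumps over a set of lattice cells. -/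
noncomputable def latticeBumps {d m : ℕ} (S : Finset (Fin d → Fin m)) (y : E d) : ℝ :=
  ∑ k ∈ S, stdBump d (y - latticeCenter k)

theorem contDiff_latticeBumps {d m : ℕ} (S : Finset (Fin d → Fin m)) :
    ContDiff ℝ ((⊤ : ℕ∞) : WithTop ℕ∞) (latticeBumps S) := by
  unfold latticeBumps
  exact ContDiff.sum fun k _ => (stdBump d).contDiff.comp (contDiff_id.sub contDiff_const)

/-- At each point at most one summand has a nonzero derivative, so the bound for a single bump
serves for every sum. That `K` depends neither on `m` nor on `S` is what makes the final constants
uniform. -/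
theorem exists_bound_iteratedFDeriv_latticeBumps (d ℓ : ℕ) :
    ∃ K : ℝ, 0 < K ∧ ∀ (m : ℕ) (S : Finset (Fin d → Fin m)), ∀ j ≤ ℓ, ∀ y,
      ‖iteratedFDeriv ℝ j (latticeBumps S) y‖ ≤ K := by
  have hψ : ContDiff ℝ ((⊤ : ℕ∞) : WithTop ℕ∞) (stdBump d) := (stdBump d).contDiff
  have hb : ∀ j : ℕ, ∃ K : ℝ, ∀ y, ‖iteratedFDeriv ℝ j (stdBump d) y‖ ≤ K := fun j =>
    ((stdBump d).hasCompactSupport.iteratedFDeriv j).exists_bound_of_continuous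
      (hψ.continuous_iteratedFDeriv (natCast_le_infty j))
  choose K hK using hb
  have hK0 : ∀ j, 0 ≤ K j := fun j => (norm_nonneg _).trans (hK j 0)
  refine ⟨∑ j ∈ Finset.range (ℓ + 1), K j + 1, by
    have := Finset.sum_nonneg fun j (_ : j ∈ Finset.range (ℓ + 1)) => hK0 j
    linarith, fun m S j hj y => ?_⟩
  have hj' : K j ≤ ∑ j ∈ Finset.range (ℓ + 1), K j + 1 := by
    have := Finset.single_le_sum (fun j _ => hK0 j) (Finset.mem_range.2 (Nat.lt_succ_of_le hj))
    linarith
  refine le_trans ?_ hj'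
  have hsum : iteratedFDeriv ℝ j (latticeBumps S) y =
      ∑ k ∈ S, iteratedFDeriv ℝ j (stdBump d) (y - latticeCenter k) := by
    have : latticeBumps S = fun y => ∑ k ∈ S, stdBump d (y - latticeCenter k) := rfl
    rw [this, iteratedFDeriv_fun_sum_apply]
    · exact Finset.sum_congr rfl fun k _ => iteratedFDeriv_comp_sub _ _ _
    · exact fun k _ => ((hψ.comp (contDiff_id.sub contDiff_const)).of_le
        (natCast_le_infty j)).contDiffAt
  have hzero : ∀ k : Fin d → Fin m, y ∉ Metric.closedBall (latticeCenter k) (1 / 3) →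
      iteratedFDeriv ℝ j (stdBump d) (y - latticeCenter k) = 0 := by
    intro k hk
    by_contra hne
    have := support_iteratedFDeriv_subset j (Function.mem_support.2 hne)
    rw [(stdBump d).tsupport_eq] at this
    apply hk
    simpa [Metric.mem_closedBall, dist_eq_norm, stdBump] using this
  rw [hsum]
  by_cases hex : ∃ k ∈ S, y ∈ Metric.closedBall (latticeCenter k) (1 / 3)
  · obtain ⟨k, hkS, hk⟩ := hex
    rw [Finset.sum_eq_single_of_mem k hkS fun l _ hl =>
      hzero l fun h => hl (eq_of_mem_closedBall_latticeCenter h hk)]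
    exact hK j _
  · push Not at hex
    rw [Finset.sum_eq_zero fun k hk => hzero k (hex k hk), norm_zero]
    exact hK0 j

/-- The bump of height `a` in the cell with index `k` of the regular partition of the cube into
`m ^ d` cells. -/
noncomputable def hump {d m : ℕ} (a : ℝ) (k : Fin d → Fin m) (x : E d) : ℝ :=
  a * stdBump d ((m : ℝ) • x - latticeCenter k)

/-- The sum of the bumps of height `a` over a set of cells. -/
noncomputable def humps {d m : ℕ} (a : ℝ) (S : Finset (Fin d → Fin m)) (x : E d) : ℝ :=
  ∑ k ∈ S, hump a k x

/-- The centre of the cell with index `k`. -/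
noncomputable def cellCenter {d m : ℕ} (k : Fin d → Fin m) : E d := (m : ℝ)⁻¹ • latticeCenter k

theorem smul_mem_closedBall_latticeCenter_iff {d m : ℕ} (hm : 0 < m) (k : Fin d → Fin m) (x : E d)
    (ρ : ℝ) : (m : ℝ) • x ∈ Metric.closedBall (latticeCenter k) ρ ↔
      x ∈ Metric.closedBall (cellCenter k) (ρ * (m : ℝ)⁻¹) := by
  have hm' : (0 : ℝ) < m := by exact_mod_cast hm
  have : (m : ℝ) • x - latticeCenter k = (m : ℝ) • (x - cellCenter k) := by
    rw [cellCenter, smul_sub, smul_smul, mul_inv_cancel₀ hm'.ne', one_smul]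
  rw [Metric.mem_closedBall, Metric.mem_closedBall, dist_eq_norm, dist_eq_norm, this, norm_smul,
    Real.norm_of_nonneg hm'.le, ← div_eq_mul_inv, le_div_iff₀ hm', mul_comm]

theorem humps_eq_latticeBumps {d m : ℕ} (a : ℝ) (S : Finset (Fin d → Fin m)) :
    humps a S = fun x => a * latticeBumps S ((m : ℝ) • x) := by
  funext x
  simp [humps, hump, latticeBumps, Finset.mul_sum]

theorem continuous_hump {d m : ℕ} (a : ℝ) (k : Fin d → Fin m) : Continuous (hump a k) := by
  unfold hump
  exact continuous_const.mul ((stdBump d).continuous.comp (by fun_prop))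

theorem continuous_humps {d m : ℕ} (a : ℝ) (S : Finset (Fin d → Fin m)) :
    Continuous (humps a S) := by
  unfold humps
  exact continuous_finsetSum _ fun k _ => continuous_hump a k

theorem exists_humps_mem_holderClass (d : ℕ) {β C : ℝ} (hβ : 0 < β) (hC : 0 < C) :
    ∃ L₀ : ℝ, 0 < L₀ ∧ ∀ L, 0 ≤ L → L ≤ L₀ → ∀ m : ℕ, 0 < m → ∀ S : Finset (Fin d → Fin m),
      humps (L * ((m : ℝ)⁻¹) ^ β) S ∈ HolderClass d β C := by
  obtain ⟨K, hK0, hK⟩ := exists_bound_iteratedFDeriv_latticeBumps d (sfloor β + 1)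
  refine ⟨C / (3 * K), by positivity, fun L hL hL' m hm S => ?_⟩
  have hm' : (1 : ℝ) ≤ m := by exact_mod_cast hm
  have h1 : 3 * (L * K) ≤ C := by
    rw [le_div_iff₀ (by positivity)] at hL'; linarith
  have := mem_holderClass_rescale (contDiff_latticeBumps S) hβ hL (h := (m : ℝ)⁻¹)
    (by positivity) (inv_le_one_of_one_le₀ hm') (hK m S) h1
  rw [humps_eq_latticeBumps]
  simpa using this

theorem hump_nonneg {d m : ℕ} {a : ℝ} (ha : 0 ≤ a) (k : Fin d → Fin m) (x : E d) :
    0 ≤ hump a k x := mul_nonneg ha (stdBump d).nonneg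

theorem hump_le {d m : ℕ} {a : ℝ} (ha : 0 ≤ a) (k : Fin d → Fin m) (x : E d) :
    hump a k x ≤ a := mul_le_of_le_one_right ha (stdBump d).le_one

theorem hump_mul_hump {d m : ℕ} (a : ℝ) {k l : Fin d → Fin m} (hkl : k ≠ l) (x : E d) :
    hump a k x * hump a l x = 0 := by
  by_cases hk : (m : ℝ) • x ∈ Metric.closedBall (latticeCenter k) (1 / 3)
  · rw [hump, hump, stdBump_sub_eq_zero (c := latticeCenter l)
      fun hl => hkl (eq_of_mem_closedBall_latticeCenter hk hl)]
    simp
  · rw [hump, stdBump_sub_eq_zero hk]; simp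

theorem humps_mul_hump {d m : ℕ} (a : ℝ) {S : Finset (Fin d → Fin m)} {k : Fin d → Fin m}
    (hk : k ∉ S) (x : E d) : humps a S x * hump a k x = 0 := by
  rw [humps, Finset.sum_mul]
  exact Finset.sum_eq_zero fun l hl => hump_mul_hump a (by rintro rfl; exact hk hl) x

theorem humps_insert {d m : ℕ} (a : ℝ) {S : Finset (Fin d → Fin m)} {k : Fin d → Fin m}
    (hk : k ∉ S) (x : E d) : humps a (insert k S) x = humps a S x + hump a k x := by
  rw [humps, Finset.sum_insert hk, humps, add_comm]

theorem humps_singleton {d m : ℕ} (a : ℝ) (k : Fin d → Fin m) :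
    humps a {k} = hump a k := by
  funext x; simp [humps]

theorem humps_empty {d m : ℕ} (a : ℝ) : humps a (∅ : Finset (Fin d → Fin m)) = 0 := by
  funext x; simp [humps]

theorem humps_nonneg {d m : ℕ} {a : ℝ} (ha : 0 ≤ a) (S : Finset (Fin d → Fin m)) (x : E d) :
    0 ≤ humps a S x := Finset.sum_nonneg fun k _ => hump_nonneg ha k x

theorem humps_le {d m : ℕ} {a : ℝ} (ha : 0 ≤ a) (S : Finset (Fin d → Fin m)) (x : E d) :
    humps a S x ≤ a := by
  by_cases hex : ∃ k ∈ S, hump a k x ≠ 0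
  · obtain ⟨k, hkS, hk⟩ := hex
    rw [humps, Finset.sum_eq_single_of_mem k hkS fun l _ hl =>
      (mul_eq_zero.1 (hump_mul_hump a hl x)).resolve_right hk]
    exact hump_le ha k x
  · push Not at hex
    rw [humps, Finset.sum_eq_zero hex]
    exact ha

/-- The plateau of the bump with index `k`. -/
def plateau {d m : ℕ} (k : Fin d → Fin m) : Set (E d) :=
  Metric.closedBall (cellCenter k) (1 / 4 * (m : ℝ)⁻¹)

theorem measurableSet_plateau {d m : ℕ} (k : Fin d → Fin m) : MeasurableSet (plateau k) :=
  Metric.isClosed_closedBall.measurableSet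

theorem hump_of_mem_plateau {d m : ℕ} (hm : 0 < m) (a : ℝ) {k : Fin d → Fin m} {x : E d}
    (hx : x ∈ plateau k) : hump a k x = a := by
  rw [plateau, ← smul_mem_closedBall_latticeCenter_iff hm] at hx
  rw [hump, (stdBump d).one_of_mem_closedBall, mul_one]
  simpa [dist_eq_norm, stdBump] using hx

theorem plateau_pairwiseDisjoint {d m : ℕ} (hm : 0 < m) :
    Pairwise (Function.onFun Disjoint (plateau : (Fin d → Fin m) → Set (E d))) := by
  intro k l hkl
  rw [Function.onFun, Set.disjoint_left]
  intro x hk hl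
  rw [plateau, ← smul_mem_closedBall_latticeCenter_iff hm] at hk hl
  exact hkl (eq_of_mem_closedBall_latticeCenter
    (Metric.closedBall_subset_closedBall (by norm_num) hk)
    (Metric.closedBall_subset_closedBall (by norm_num) hl))

theorem plateau_subset_cube {d m : ℕ} (hm : 0 < m) (k : Fin d → Fin m) : plateau k ⊆ cube d := by
  have hm' : (0 : ℝ) < m := by exact_mod_cast hm
  apply ball_subset_cube
  intro i
  have h1 : ((k i : ℕ) : ℝ) + 1 ≤ m := by exact_mod_cast (k i).2
  have h0 : (0 : ℝ) ≤ (k i : ℕ) := by positivity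
  have hc : cellCenter k i = (m : ℝ)⁻¹ * ((k i : ℕ) + 1 / 2) := by
    simp [cellCenter, latticeCenter]
  have hinv : (m : ℝ)⁻¹ * m = 1 := inv_mul_cancel₀ hm'.ne'
  have hp : 0 < (m : ℝ)⁻¹ := inv_pos.2 hm'
  rw [hc]
  constructor <;> nlinarith

theorem cellCenter_mem_plateau {d m : ℕ} (k : Fin d → Fin m) : cellCenter k ∈ plateau k :=
  Metric.mem_closedBall_self (by positivity)

theorem volume_plateau {d m : ℕ} (k : Fin d → Fin m) :
    volume (plateau k) = ENNReal.ofReal ((1 / 4 * (m : ℝ)⁻¹) ^ d) *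
      volume (Metric.ball (0 : E d) 1) := by
  rw [plateau, Measure.addHaar_closedBall _ _ (by positivity), finrank_euclideanSpace_fin]

/-- The bump has height at most `a` and lives on a ball of radius `1/(3m)`. Divided by `σ²`, this
integral is the information about one bump carried by one observation. -/
theorem integral_hump_sq_le {d m : ℕ} (hm : 0 < m) (a : ℝ) (k : Fin d → Fin m) :
    ∫ x in cube d, hump a k x * hump a k x ≤
      a ^ 2 * (((m : ℝ)⁻¹) ^ d * (volume (Metric.ball (0 : E d) 1)).toReal) := by
  set B := Metric.closedBall (cellCenter k) (1 / 3 * (m : ℝ)⁻¹) with hB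
  have hBm : MeasurableSet B := Metric.isClosed_closedBall.measurableSet
  have hBt : volume B ≠ ⊤ := measure_closedBall_lt_top.ne
  have hle : ∀ x, hump a k x * hump a k x ≤ B.indicator (fun _ => a ^ 2) x := by
    intro x
    by_cases hx : x ∈ B
    · rw [Set.indicator_of_mem hx, hump]
      have h0 := (stdBump d).nonneg (x := (m : ℝ) • x - latticeCenter k)
      have h1 := (stdBump d).le_one (x := (m : ℝ) • x - latticeCenter k)
      have h2 := mul_le_one₀ h1 h0 h1
      nlinarith [sq_nonneg a]
    · rw [Set.indicator_of_notMem hx, hump, stdBump_sub_eq_zero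
        (by rw [smul_mem_closedBall_latticeCenter_iff hm]; exact hx)]
      simp
  have hint : Integrable (B.indicator fun _ => a ^ 2) (volume : Measure (E d)) :=
    (integrable_indicator_iff hBm).2 (integrableOn_const hBt)
  have hnn : 0 ≤ B.indicator (fun _ : E d => a ^ 2) :=
    fun x => Set.indicator_nonneg (fun _ _ => sq_nonneg a) x
  calc ∫ x in cube d, hump a k x * hump a k x
      ≤ ∫ x in cube d, B.indicator (fun _ => a ^ 2) x :=
        integral_mono_of_nonneg (Filter.Eventually.of_forall fun x => mul_self_nonneg _)
          hint.integrableOn (Filter.Eventually.of_forall hle)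
    _ ≤ ∫ x, B.indicator (fun _ => a ^ 2) x :=
        setIntegral_le_integral hint (Filter.Eventually.of_forall hnn)
    _ = a ^ 2 * (volume B).toReal := by
        rw [integral_indicator hBm, setIntegral_const, smul_eq_mul, mul_comm]; rfl
    _ ≤ _ := by
        refine mul_le_mul_of_nonneg_left ?_ (sq_nonneg a)
        rw [hB, Measure.addHaar_closedBall _ _ (by positivity), finrank_euclideanSpace_fin,
          ENNReal.toReal_mul, ENNReal.toReal_ofReal (by positivity)]
        refine mul_le_mul_of_nonneg_right ?_ ENNReal.toReal_nonneg
        refine pow_le_pow_left₀ (by positivity) ?_ _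
        have : 0 ≤ (m : ℝ)⁻¹ := by positivity
        linarith

/-! ### The two-valued regression model and its likelihood ratios -/

/-- The law of `(X, Y)` with `X` uniform on the cube and `Y = ± σ` with conditional mean `f X`. -/
noncomputable def law {d : ℕ} (σ : ℝ) (f : E d → ℝ) : Measure (E d × ℝ) :=
  ((volume.restrict (cube d)).withDensity
      fun x => ENNReal.ofReal ((1 + f x / σ) / 2)).map (fun x => (x, σ)) +
    ((volume.restrict (cube d)).withDensity
      fun x => ENNReal.ofReal ((1 - f x / σ) / 2)).map (fun x => (x, -σ))

/-- The likelihood ratio of the laws with regression functions `f + g` and `f`, for `f * g = 0`. -/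
noncomputable def tilt {d : ℕ} (σ : ℝ) (g : E d → ℝ) (w : E d × ℝ) : ℝ≥0∞ :=
  ENNReal.ofReal (1 + w.2 * g w.1 / σ ^ 2)

theorem measurable_tilt {d : ℕ} (σ : ℝ) {g : E d → ℝ} (hg : Measurable g) :
    Measurable (tilt σ g) := by
  unfold tilt; fun_prop

theorem div_mem_Icc {σ u : ℝ} (hσ : 0 < σ) (hu : |u| ≤ σ) : -1 ≤ u / σ ∧ u / σ ≤ 1 := by
  have := abs_le.1 hu
  rw [div_le_one hσ, le_div_iff₀ hσ]
  constructor <;> linarith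

theorem lintegral_law {d : ℕ} (σ : ℝ) {f : E d → ℝ} (hf : Measurable f)
    {G : E d × ℝ → ℝ≥0∞} (hG : Measurable G) :
    ∫⁻ w, G w ∂(law σ f) = ∫⁻ x in cube d, (ENNReal.ofReal ((1 + f x / σ) / 2) * G (x, σ) +
      ENNReal.ofReal ((1 - f x / σ) / 2) * G (x, -σ)) := by
  unfold law
  rw [lintegral_add_measure, lintegral_map hG (by fun_prop), lintegral_map hG (by fun_prop),
    lintegral_withDensity_eq_lintegral_mul _ (by fun_prop) (by fun_prop),
    lintegral_withDensity_eq_lintegral_mul _ (by fun_prop) (by fun_prop),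
    ← lintegral_add_left (by fun_prop)]
  rfl

theorem ofReal_half_add {u : ℝ} (h1 : -1 ≤ u) (h2 : u ≤ 1) :
    ENNReal.ofReal ((1 + u) / 2) + ENNReal.ofReal ((1 - u) / 2) = 1 := by
  rw [← ENNReal.ofReal_add (by linarith) (by linarith)]
  rw [show (1 + u) / 2 + (1 - u) / 2 = 1 by ring, ENNReal.ofReal_one]

theorem map_fst_law {d : ℕ} {σ : ℝ} (hσ : 0 < σ) {f : E d → ℝ} (hf : Measurable f)
    (hfσ : ∀ x, |f x| ≤ σ) : (law σ f).map Prod.fst = volume.restrict (cube d) := by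
  refine Measure.ext_of_lintegral _ fun G hG => ?_
  rw [lintegral_map hG measurable_fst, lintegral_law σ hf (G := fun w => G w.1)
    (hG.comp measurable_fst)]
  refine lintegral_congr fun x => ?_
  obtain ⟨h1, h2⟩ := div_mem_Icc hσ (hfσ x)
  rw [← add_mul, ofReal_half_add h1 h2, one_mul]

theorem isProbabilityMeasure_law {d : ℕ} {σ : ℝ} (hσ : 0 < σ) {f : E d → ℝ} (hf : Measurable f)
    (hfσ : ∀ x, |f x| ≤ σ) : IsProbabilityMeasure (law σ f) := by
  constructor
  have := congrArg (fun μ => μ univ) (map_fst_law hσ hf hfσ)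
  simpa [Measure.map_apply measurable_fst MeasurableSet.univ, volume_cube] using this

theorem ae_law {d : ℕ} (σ : ℝ) (f : E d → ℝ) : ∀ᵐ w ∂(law σ f), w.2 = σ ∨ w.2 = -σ := by
  have hS : MeasurableSet {w : E d × ℝ | w.2 = σ ∨ w.2 = -σ} :=
    (measurableSet_eq_fun measurable_snd measurable_const).union
      (measurableSet_eq_fun measurable_snd measurable_const)
  unfold law
  rw [ae_add_measure_iff, ae_map_iff (by fun_prop) hS, ae_map_iff (by fun_prop) hS]
  simp

theorem ae_law_fst_mem {d : ℕ} {σ : ℝ} (hσ : 0 < σ) {f : E d → ℝ} (hf : Measurable f)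
    (hfσ : ∀ x, |f x| ≤ σ) : ∀ᵐ w ∂(law σ f), w.1 ∈ cube d := by
  have h : ∀ᵐ x ∂((law σ f).map Prod.fst), x ∈ cube d := by
    rw [map_fst_law hσ hf hfσ]
    exact ae_restrict_mem (measurableSet_cube d)
  exact ae_of_ae_map measurable_fst.aemeasurable h

/-- Since `f * g = 0`, the weights factor: `1 ± (f + g)/σ = (1 ± f/σ)(1 ± g/σ)`. -/
theorem law_add {d : ℕ} {σ : ℝ} (hσ : 0 < σ) {f g : E d → ℝ} (hf : Measurable f)
    (hg : Measurable g) (hgσ : ∀ x, |g x| ≤ σ) (hfσ : ∀ x, |f x| ≤ σ)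
    (hfg : ∀ x, f x * g x = 0) :
    law σ (fun x => f x + g x) = (law σ f).withDensity (tilt σ g) := by
  refine Measure.ext_of_lintegral _ fun G hG => ?_
  rw [lintegral_withDensity_eq_lintegral_mul _ (measurable_tilt σ hg) hG,
    lintegral_law σ (by fun_prop) hG, lintegral_law σ hf ((measurable_tilt σ hg).mul hG)]
  refine lintegral_congr fun x => ?_
  obtain ⟨h1, h2⟩ := div_mem_Icc hσ (hgσ x)
  obtain ⟨h3, h4⟩ := div_mem_Icc hσ (hfσ x)
  have e : f x / σ * (g x / σ) = 0 := by
    rw [div_mul_div_comm, hfg, zero_div]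
  simp only [Pi.mul_apply, tilt]
  rw [← mul_assoc, ← mul_assoc, ← ENNReal.ofReal_mul (by linarith),
    ← ENNReal.ofReal_mul (by linarith)]
  have hσ' := hσ.ne'
  congr 3
  · rw [show σ * g x / σ ^ 2 = g x / σ by field_simp, add_div]
    linear_combination (-1 / 2) * e
  · rw [show -σ * g x / σ ^ 2 = -(g x / σ) by field_simp, add_div]
    linear_combination (-1 / 2) * e

/-- Averaging `1 ± g/σ` with the weights `(1 ± f/σ)/2` leaves `1 + f g / σ²`. Without `f * g = 0`
the total mass need not be one; the excess gives the second moments below. -/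
theorem lintegral_tilt_law {d : ℕ} {σ : ℝ} (hσ : 0 < σ) {f g : E d → ℝ} (hf : Continuous f)
    (hg : Continuous g) (hgσ : ∀ x, |g x| ≤ σ) (hfσ : ∀ x, |f x| ≤ σ) :
    ∫⁻ w, tilt σ g w ∂(law σ f) = ENNReal.ofReal (1 + (∫ x in cube d, f x * g x) / σ ^ 2) := by
  rw [lintegral_law σ hf.measurable (measurable_tilt σ hg.measurable)]
  have hfin : IsFiniteMeasure (volume.restrict (cube d)) :=
    ⟨by simp [volume_cube]⟩
  have hint : Integrable (fun x => f x * g x) (volume.restrict (cube d)) := by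
    refine Integrable.of_bound (hf.mul hg).aestronglyMeasurable (σ * σ)
      (Filter.Eventually.of_forall fun x => ?_)
    rw [norm_mul]
    exact mul_le_mul (hfσ x) (hgσ x) (norm_nonneg _) hσ.le
  have e1 : (1 : ℝ) + (∫ x in cube d, f x * g x) / σ ^ 2 =
      ∫ x in cube d, (1 + f x * g x / σ ^ 2) := by
    rw [integral_add (integrable_const _) (hint.div_const _), integral_div]
    simp [Measure.real, volume_cube]
  have hb : ∀ x, |f x * g x / σ ^ 2| ≤ 1 := by
    intro x
    have h1 := hgσ x
    have h2 := hfσ x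
    rw [abs_div, abs_mul, abs_of_pos (by positivity : (0 : ℝ) < σ ^ 2), div_le_one (by positivity),
      sq]
    exact mul_le_mul h2 h1 (abs_nonneg _) hσ.le
  have e2 : Integrable (fun x => 1 + f x * g x / σ ^ 2) (volume.restrict (cube d)) :=
    (integrable_const _).add (hint.div_const _)
  rw [e1, ofReal_integral_eq_lintegral_ofReal e2
    (Filter.Eventually.of_forall fun x => by
      have := abs_le.1 (hb x)
      simp only [Pi.zero_apply]
      linarith)]
  refine lintegral_congr fun x => ?_
  obtain ⟨h1, h2⟩ := div_mem_Icc hσ (hgσ x)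
  obtain ⟨h3, h4⟩ := div_mem_Icc hσ (hfσ x)
  have hσ' := hσ.ne'
  have t1 : tilt σ g (x, σ) = ENNReal.ofReal (1 + g x / σ) := by
    rw [tilt]; congr 2; field_simp
  have t2 : tilt σ g (x, -σ) = ENNReal.ofReal (1 - g x / σ) := by
    rw [tilt]; congr 1; field_simp; ring
  rw [t1, t2, ← ENNReal.ofReal_mul (by linarith), ← ENNReal.ofReal_mul (by linarith),
    ← ENNReal.ofReal_add (mul_nonneg (by linarith) (by linarith))
      (mul_nonneg (by linarith) (by linarith))]
  congr 1
  field_simp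
  ring

/-- The conditional mean given `X = x` of a function of `(X, Y)` under `law σ f`. -/
noncomputable def condMean {d : ℕ} (σ : ℝ) (f : E d → ℝ) (ψ : E d × ℝ → ℝ) (x : E d) : ℝ :=
  (1 + f x / σ) / 2 * ψ (x, σ) + (1 - f x / σ) / 2 * ψ (x, -σ)

/-- The bound on `ψ` is required only at `y = ±σ`, where the law is carried; this admits the
exponentials of the noise, which are unbounded in `y`. -/
theorem integral_law {d : ℕ} {σ : ℝ} (hσ : 0 < σ) {f : E d → ℝ} (hf : Measurable f)
    (hfσ : ∀ x, |f x| ≤ σ) {ψ : E d × ℝ → ℝ} (hψ : Measurable ψ) {M : ℝ}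
    (hM1 : ∀ x, |ψ (x, σ)| ≤ M) (hM2 : ∀ x, |ψ (x, -σ)| ≤ M) :
    Integrable ψ (law σ f) ∧ ∫ w, ψ w ∂(law σ f) = ∫ x in cube d, condMean σ f ψ x := by
  have := isProbabilityMeasure_law hσ hf hfσ
  have hfin : IsFiniteMeasure (volume.restrict (cube d)) :=
    ⟨by simp [volume_cube]⟩
  have hint : Integrable ψ (law σ f) := by
    refine Integrable.of_bound hψ.aestronglyMeasurable M ?_
    filter_upwards [ae_law σ f] with w hw
    obtain ⟨x, y⟩ := w
    rcases hw with h | h <;> simp only at h <;> subst h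
    · exact hM1 x
    · exact hM2 x
  refine ⟨hint, ?_⟩
  have hint' := hint
  unfold law at hint' ⊢
  rw [integrable_add_measure] at hint'
  have hb : ∀ x, |f x / σ| ≤ 1 := fun x => abs_le.2 (div_mem_Icc hσ (hfσ x))
  have i1 : Integrable (fun x => (1 + f x / σ) / 2 * ψ (x, σ)) (volume.restrict (cube d)) := by
    refine Integrable.of_bound (by fun_prop) (1 * M) (Filter.Eventually.of_forall fun x => ?_)
    rw [norm_mul]
    refine mul_le_mul ?_ (hM1 x) (norm_nonneg _) zero_le_one
    have := abs_le.1 (hb x)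
    rw [Real.norm_eq_abs, abs_le]; constructor <;> linarith
  have i2 : Integrable (fun x => (1 - f x / σ) / 2 * ψ (x, -σ)) (volume.restrict (cube d)) := by
    refine Integrable.of_bound (by fun_prop) (1 * M) (Filter.Eventually.of_forall fun x => ?_)
    rw [norm_mul]
    refine mul_le_mul ?_ (hM2 x) (norm_nonneg _) zero_le_one
    have := abs_le.1 (hb x)
    rw [Real.norm_eq_abs, abs_le]; constructor <;> linarith
  rw [integral_add_measure hint'.1 hint'.2,
    integral_map (by fun_prop) hψ.aestronglyMeasurable,
    integral_map (by fun_prop) hψ.aestronglyMeasurable,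
    integral_withDensity_eq_integral_toReal_smul (by fun_prop) (by simp),
    integral_withDensity_eq_integral_toReal_smul (by fun_prop) (by simp)]
  unfold condMean
  rw [integral_add i1 i2]
  congr 1 <;> refine integral_congr_ae (Filter.Eventually.of_forall fun x => ?_)
  all_goals
    have := abs_le.1 (hb x)
    simp only [smul_eq_mul]
    rw [ENNReal.toReal_ofReal (by linarith)]

/-- `condMean` is a function of the first coordinate, and it has the same integral as `ψ` over the
preimage of every measurable set of covariates, since multiplying by an indicator in `x` commutes
with `condMean`. -/
theorem condExp_law {d : ℕ} {σ : ℝ} (hσ : 0 < σ) {f : E d → ℝ} (hf : Measurable f)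
    (hfσ : ∀ x, |f x| ≤ σ) {ψ : E d × ℝ → ℝ} (hψ : Measurable ψ) {M : ℝ}
    (hM1 : ∀ x, |ψ (x, σ)| ≤ M) (hM2 : ∀ x, |ψ (x, -σ)| ≤ M) :
    (law σ f)[ψ | sigmaX d] =ᵐ[law σ f] fun w => condMean σ f ψ w.1 := by
  have := isProbabilityMeasure_law hσ hf hfσ
  have hm : sigmaX d ≤ (inferInstance : MeasurableSpace (E d × ℝ)) :=
    measurable_fst.comap_le
  have hcm : Measurable (condMean σ f ψ) := by unfold condMean; fun_prop
  have hb : ∀ x, |f x / σ| ≤ 1 := fun x => abs_le.2 (div_mem_Icc hσ (hfσ x))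
  have hcb : ∀ x, |condMean σ f ψ x| ≤ M := by
    intro x
    have h0 := abs_le.1 (hb x)
    have h1 := abs_le.1 (hM1 x)
    have h2 := abs_le.1 (hM2 x)
    unfold condMean
    rw [abs_le]
    constructor <;> nlinarith
  have hM0 : 0 ≤ M := (abs_nonneg _).trans (hM1 0)
  refine (ae_eq_condExp_of_forall_setIntegral_eq hm (integral_law hσ hf hfσ hψ hM1 hM2).1
    (fun s _ _ => ?_) (fun s hs _ => ?_) ?_).symm
  · exact (integral_law hσ hf hfσ (ψ := fun w => condMean σ f ψ w.1) (hcm.comp measurable_fst)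
      hcb hcb).1.integrableOn
  · obtain ⟨B, hB, rfl⟩ := hs
    have hB' : MeasurableSet (Prod.fst ⁻¹' B : Set (E d × ℝ)) := measurable_fst hB
    have hind : ∀ (φ : E d × ℝ → ℝ) (w), |φ w| ≤ M →
        |(Prod.fst ⁻¹' B).indicator φ w| ≤ M := by
      intro φ w h
      by_cases hw : w ∈ (Prod.fst ⁻¹' B : Set (E d × ℝ))
      · rwa [indicator_of_mem hw]
      · rw [indicator_of_notMem hw, abs_zero]; exact hM0
    rw [← integral_indicator hB', ← integral_indicator hB',
      (integral_law hσ hf hfσ (ψ := (Prod.fst ⁻¹' B).indicator fun w => condMean σ f ψ w.1)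
        ((hcm.comp measurable_fst).indicator hB')
        (fun x => hind _ _ (hcb x)) (fun x => hind _ _ (hcb x))).2,
      (integral_law hσ hf hfσ (hψ.indicator hB')
        (fun x => hind _ _ (hM1 x)) (fun x => hind _ _ (hM2 x))).2]
    refine integral_congr_ae (Filter.Eventually.of_forall fun x => ?_)
    by_cases hx : x ∈ B
    · simp [condMean, indicator, hx]
      ring
    · simp [condMean, indicator, hx]
  · exact (hcm.comp (comap_measurable _)).aestronglyMeasurable

/-- Hoeffding's lemma for the two-point distribution on `± σ` with mean `u`. -/
theorem two_point_exp_le {σ u : ℝ} (hσ : 0 < σ) (hu : |u| ≤ σ) (t : ℝ) :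
    (1 + u / σ) / 2 * Real.exp (t * (σ - u)) + (1 - u / σ) / 2 * Real.exp (t * (-σ - u)) ≤
      Real.exp (t ^ 2 * σ ^ 2 / 2) := by
  obtain ⟨h1, h2⟩ := div_mem_Icc hσ hu
  have p1 : 0 ≤ (1 + u / σ) / 2 := by linarith
  have p2 : 0 ≤ (1 - u / σ) / 2 := by linarith
  let μ : Measure ℝ := ENNReal.ofReal ((1 + u / σ) / 2) • Measure.dirac σ +
    ENNReal.ofReal ((1 - u / σ) / 2) • Measure.dirac (-σ)
  have hμ : IsProbabilityMeasure μ := ⟨by simp [μ, ofReal_half_add h1 h2]⟩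
  have hint : ∀ g : ℝ → ℝ, ∫ y, g y ∂μ =
      (1 + u / σ) / 2 * g σ + (1 - u / σ) / 2 * g (-σ) := by
    intro g
    have hd : ∀ a : ℝ, Integrable g (Measure.dirac a) := fun a =>
      integrable_dirac (by simp)
    simp only [μ]
    rw [integral_add_measure ((hd _).smul_measure ENNReal.ofReal_ne_top)
      ((hd _).smul_measure ENNReal.ofReal_ne_top), integral_smul_measure, integral_smul_measure,
      integral_dirac, integral_dirac, ENNReal.toReal_ofReal p1, ENNReal.toReal_ofReal p2]
    simp
  have hmean : ∫ y, y ∂μ = u := by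
    rw [hint]; field_simp; ring
  have hmem : ∀ᵐ y ∂μ, y ∈ Icc (-σ) σ := by
    have : ∀ a ∈ Icc (-σ) σ, ∀ᵐ y ∂(Measure.dirac a), y ∈ Icc (-σ) σ := fun a ha => by
      exact (ae_dirac_iff (p := fun y => y ∈ Icc (-σ) σ) measurableSet_Icc).2 ha
    simp only [μ]
    rw [ae_add_measure_iff]
    exact ⟨Measure.ae_smul_measure (this _ ⟨by linarith, le_rfl⟩) _,
      Measure.ae_smul_measure (this _ ⟨le_rfl, by linarith⟩) _⟩
  -- The variance proxy is the squared half-length of `[-σ, σ]`, which is `σ²`.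
  have := (hasSubgaussianMGF_of_mem_Icc (μ := μ) (X := fun y : ℝ => y)
    measurable_id.aemeasurable hmem).mgf_le t
  rw [mgf, hmean, hint] at this
  refine this.trans (le_of_eq ?_)
  congr 1
  push_cast
  rw [Real.norm_of_nonneg (by linarith)]
  ring

/-- The uniform density 1 is admissible because `μmin < 1 < μmax`, and `two_point_exp_le` controls
the noise. -/
theorem inClass_law {d : ℕ} {β C μmin μmax σ : ℝ} (hμ1 : μmin < 1) (hμ2 : 1 < μmax)
    (hσ : 0 < σ) {f : E d → ℝ} (hf : Measurable f) (hfσ : ∀ x, |f x| ≤ σ)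
    (hfH : f ∈ HolderClass d β C) : InClass β C μmin μmax σ (law σ f) f := by
  have hmeas : ∀ t : ℝ, Measurable fun w : E d × ℝ => Real.exp (t * (w.2 - f w.1)) :=
    fun t => by fun_prop
  have hbd : ∀ (t y : ℝ) (x : E d), |y| ≤ σ →
      |Real.exp (t * (y - f x))| ≤ Real.exp (|t| * (2 * σ)) := by
    intro t y x hy
    rw [Real.abs_exp, Real.exp_le_exp]
    refine (le_abs_self _).trans ?_
    rw [abs_mul]
    refine mul_le_mul_of_nonneg_left ?_ (abs_nonneg _)
    have := abs_sub y (f x)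
    have := hfσ x
    linarith
  have hσ1 : |σ| ≤ σ := (abs_of_pos hσ).le
  have hσ2 : |-σ| ≤ σ := by rw [abs_neg]; exact hσ1
  have hsnd : Measurable fun w : E d × ℝ => w.2 := measurable_snd
  refine ⟨isProbabilityMeasure_law hσ hf hfσ, hfH, ⟨fun _ => 1, measurable_const,
    fun _ _ => ⟨hμ1, hμ2⟩, ?_⟩, ?_, ?_, fun t => ?_, fun t => ?_⟩
  · rw [map_fst_law hσ hf hfσ]; simp
  · exact (integral_law hσ hf hfσ hsnd (fun _ => hσ1) (fun _ => hσ2)).1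
  · refine (condExp_law hσ hf hfσ hsnd (fun _ => hσ1) (fun _ => hσ2)).trans
      (Filter.Eventually.of_forall fun w => ?_)
    simp only [condMean]
    field_simp
    ring
  · exact (integral_law hσ hf hfσ (hmeas t) (fun x => hbd t _ x hσ1) (fun x => hbd t _ x hσ2)).1
  · refine (condExp_law hσ hf hfσ (hmeas t) (fun x => hbd t _ x hσ1)
      (fun x => hbd t _ x hσ2)).trans_le (Filter.Eventually.of_forall fun w => ?_)
    exact two_point_exp_le hσ (hfσ w.1) t

/-! ### Product measures and the two-point bound -/

theorem lintegral_pi_prod {α : Type*} [MeasurableSpace α] (μ : Measure α) [IsProbabilityMeasure μ]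
    (n : ℕ) (G : Fin n → α → ℝ≥0∞) (hG : ∀ i, Measurable (G i)) :
    ∫⁻ z, ∏ i, G i (z i) ∂(Measure.pi fun _ : Fin n => μ) = ∏ i, ∫⁻ w, G i w ∂μ := by
  have h := lintegral_prod_eq_prod_lintegral_of_indepFun Finset.univ
    (fun i (z : Fin n → α) => G i (z i))
    (iIndepFun_pi (μ := fun _ : Fin n => μ) (X := G) fun i => (hG i).aemeasurable)
    (fun i => (hG i).comp (measurable_pi_apply i))
  rw [h]
  refine Finset.prod_congr rfl fun i _ => ?_
  exact (measurePreserving_eval (fun _ : Fin n => μ) i).lintegral_comp (hG i)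

theorem pi_withDensity {α : Type*} [MeasurableSpace α] (μ : Measure α) [IsProbabilityMeasure μ]
    (n : ℕ) {D : α → ℝ≥0∞} (hD : Measurable D) [IsProbabilityMeasure (μ.withDensity D)] :
    (Measure.pi fun _ : Fin n => μ.withDensity D) =
      (Measure.pi fun _ : Fin n => μ).withDensity fun z => ∏ i, D (z i) := by
  refine (Measure.pi_eq fun s hs => ?_)
  rw [withDensity_apply _ (MeasurableSet.univ_pi hs), ← lintegral_indicator (MeasurableSet.univ_pi hs)]
  have : ∀ z : Fin n → α, (univ.pi s).indicator (fun z => ∏ i, D (z i)) z =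
      ∏ i, (s i).indicator D (z i) := by
    intro z
    by_cases hz : z ∈ univ.pi s
    · rw [indicator_of_mem hz]
      exact Finset.prod_congr rfl fun i _ => (indicator_of_mem (hz i (mem_univ i)) D).symm
    · rw [indicator_of_notMem hz]
      simp only [mem_pi, mem_univ, true_implies, not_forall] at hz
      obtain ⟨i, hi⟩ := hz
      exact (Finset.prod_eq_zero (Finset.mem_univ i) (indicator_of_notMem hi D)).symm
  simp_rw [this]
  rw [lintegral_pi_prod μ n (fun i => (s i).indicator D) fun i => hD.indicator (hs i)]
  exact Finset.prod_congr rfl fun i _ => by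
    rw [lintegral_indicator (hs i), withDensity_apply _ (hs i)]

/-- For `L ≥ 1` this is `(L - 2)² ≥ 0`. It bounds the overlap of two measures from below by a second
moment alone, without total variation. -/
theorem le_min_one_add_sq (L : ℝ≥0∞) : L ≤ min 1 L + L * L * 4⁻¹ := by
  rcases le_total L 1 with h | h
  · rw [min_eq_right h]; exact le_self_add
  · rw [min_eq_left h]
    induction L with
    | top => simp
    | coe x =>
      have : (x : ℝ) ≤ 1 + x * x * 4⁻¹ := by nlinarith [sq_nonneg ((x : ℝ) - 2)]
      have h4 : (4 : ℝ≥0∞)⁻¹ = ((4⁻¹ : NNReal) : ℝ≥0∞) := by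
        rw [ENNReal.coe_inv (by norm_num)]; rfl
      rw [h4]
      exact_mod_cast this

/-- Le Cam's two-point bound, under a second-moment condition on the likelihood ratio. -/
theorem half_le_lintegral_add_of_sq_le {α : Type*} [MeasurableSpace α] {μ : Measure α}
    {L a b : α → ℝ≥0∞} (hL : Measurable L) (ha : Measurable a) (hb : Measurable b)
    (h1 : ∫⁻ z, L z ∂μ = 1) (h2 : ∫⁻ z, L z * L z ∂μ ≤ 2) {s : ℝ≥0∞} (hs : ∀ z, s ≤ a z + b z) :
    s * 2⁻¹ ≤ ∫⁻ z, a z ∂μ + ∫⁻ z, b z ∂(μ.withDensity L) := by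
  have hmin : Measurable fun z => min 1 (L z) := measurable_const.min hL
  -- The overlap of the two measures: `1 = ∫ L ≤ ∫ min 1 L + 2/4`.
  have e1 : (2 : ℝ≥0∞)⁻¹ ≤ ∫⁻ z, min 1 (L z) ∂μ := by
    have h3 : (1 : ℝ≥0∞) ≤ ∫⁻ z, min 1 (L z) ∂μ + 2⁻¹ := by
      calc (1 : ℝ≥0∞) = ∫⁻ z, L z ∂μ := h1.symm
        _ ≤ ∫⁻ z, (min 1 (L z) + L z * L z * 4⁻¹) ∂μ :=
          lintegral_mono fun z => le_min_one_add_sq _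
        _ = ∫⁻ z, min 1 (L z) ∂μ + (∫⁻ z, L z * L z ∂μ) * 4⁻¹ := by
          rw [lintegral_add_left hmin, lintegral_mul_const (f := fun z => L z * L z) _ (hL.mul hL)]
        _ ≤ ∫⁻ z, min 1 (L z) ∂μ + 2 * 4⁻¹ := by gcongr
        _ = _ := by
          congr 1
          rw [show (4 : ℝ≥0∞) = 2 * 2 by norm_num, ENNReal.mul_inv (by simp) (by simp), ← mul_assoc,
            ENNReal.mul_inv_cancel (by simp) (by simp), one_mul]
    have h4 : (2 : ℝ≥0∞)⁻¹ + 2⁻¹ ≤ ∫⁻ z, min 1 (L z) ∂μ + 2⁻¹ := by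
      rwa [ENNReal.inv_two_add_inv_two]
    exact (ENNReal.add_le_add_iff_right (by simp : (2 : ℝ≥0∞)⁻¹ ≠ ⊤)).1 h4
  rw [lintegral_withDensity_eq_lintegral_mul _ hL hb, ← lintegral_add_left ha]
  calc s * 2⁻¹ ≤ s * ∫⁻ z, min 1 (L z) ∂μ := by gcongr
    _ = ∫⁻ z, s * min 1 (L z) ∂μ := (lintegral_const_mul _ hmin).symm
    _ ≤ ∫⁻ z, (a z + (L * b) z) ∂μ := by
      refine lintegral_mono fun z => ?_
      calc s * min 1 (L z) ≤ (a z + b z) * min 1 (L z) := by gcongr; exact hs z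
        _ = a z * min 1 (L z) + b z * min 1 (L z) := add_mul _ _ _
        _ ≤ a z * 1 + b z * L z :=
          add_le_add (mul_le_mul_right (min_le_left _ _) _) (mul_le_mul_right (min_le_right _ _) _)
        _ = a z + (L * b) z := by rw [mul_one, Pi.mul_apply, mul_comm (b z)]

/-- Absorbing `tilt σ g` into the measure turns `f` into `f + g`; then `lintegral_tilt_law` applies
to `g'`, and `f * g' = 0` leaves only `g * g'`. -/
theorem lintegral_tilt_mul_tilt {d : ℕ} {σ : ℝ} (hσ : 0 < σ) {f g g' : E d → ℝ} (hf : Continuous f)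
    (hg : Continuous g) (hg' : Continuous g') (hfσ : ∀ x, |f x| ≤ σ) (hgσ : ∀ x, |g x| ≤ σ)
    (hgσ' : ∀ x, |g' x| ≤ σ) (hfg : ∀ x, f x * g x = 0) (hfg' : ∀ x, f x * g' x = 0)
    (hfgσ : ∀ x, |f x + g x| ≤ σ) :
    ∫⁻ w, tilt σ g w * tilt σ g' w ∂(law σ f) =
      ENNReal.ofReal (1 + (∫ x in cube d, g x * g' x) / σ ^ 2) := by
  have h1 := lintegral_withDensity_eq_lintegral_mul (law σ f) (measurable_tilt σ hg.measurable)
    (measurable_tilt σ hg'.measurable)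
  rw [← law_add hσ hf.measurable hg.measurable hgσ hfσ hfg,
    lintegral_tilt_law (f := fun x => f x + g x) hσ (hf.add hg) hg' hgσ' hfgσ] at h1
  refine h1.symm.trans ?_
  congr 4 with x
  rw [add_mul, hfg', zero_add]

theorem lintegral_tilt_eq_one {d : ℕ} {σ : ℝ} (hσ : 0 < σ) {f g : E d → ℝ} (hf : Continuous f)
    (hg : Continuous g) (hfσ : ∀ x, |f x| ≤ σ) (hgσ : ∀ x, |g x| ≤ σ)
    (hfg : ∀ x, f x * g x = 0) : ∫⁻ w, tilt σ g w ∂(law σ f) = 1 := by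
  rw [lintegral_tilt_law hσ hf hg hgσ hfσ]
  simp [hfg]

theorem pi_law_add {d : ℕ} (n : ℕ) {σ : ℝ} (hσ : 0 < σ) {f g : E d → ℝ} (hf : Continuous f)
    (hg : Continuous g) (hfσ : ∀ x, |f x| ≤ σ) (hgσ : ∀ x, |g x| ≤ σ)
    (hfg : ∀ x, f x * g x = 0) (hfgσ : ∀ x, |f x + g x| ≤ σ) :
    (Measure.pi fun _ : Fin n => law σ fun x => f x + g x) =
      (Measure.pi fun _ : Fin n => law σ f).withDensity fun z => ∏ i, tilt σ g (z i) := by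
  have h0 := law_add hσ hf.measurable hg.measurable hgσ hfσ hfg
  have h1 := isProbabilityMeasure_law hσ hf.measurable hfσ
  have h2 := isProbabilityMeasure_law hσ (f := fun x => f x + g x)
    (hf.measurable.add hg.measurable) hfgσ
  rw [h0] at h2 ⊢
  exact pi_withDensity _ n (measurable_tilt σ hg.measurable)

theorem measurable_prod_tilt {d : ℕ} (n : ℕ) (σ : ℝ) {g : E d → ℝ} (hg : Measurable g) :
    Measurable fun z : Sample d n => ∏ i, tilt σ g (z i) :=
  Finset.measurable_prod _ fun i _ => (measurable_tilt σ hg).comp (measurable_pi_apply i)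

theorem ofReal_pow_le_ofReal {u v : ℝ} {n : ℕ} (hu : 0 ≤ u) (h : u ^ n ≤ v) :
    ENNReal.ofReal u ^ n ≤ ENNReal.ofReal v := by
  rw [← ENNReal.ofReal_pow hu]; exact ENNReal.ofReal_le_ofReal h

/-! ### Lower bounds over families of bumps -/

section Assouad

variable {d m n : ℕ} {σ a I : ℝ}

theorem abs_humps_le (ha : 0 < a) (haσ : a ≤ σ) (S : Finset (Fin d → Fin m)) (x : E d) :
    |humps a S x| ≤ σ := by
  rw [abs_of_nonneg (humps_nonneg ha.le S x)]
  exact (humps_le ha.le S x).trans haσ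

theorem abs_hump_le (ha : 0 < a) (haσ : a ≤ σ) (k : Fin d → Fin m) (x : E d) :
    |hump a k x| ≤ σ := by
  rw [abs_of_nonneg (hump_nonneg ha.le k x)]
  exact (hump_le ha.le k x).trans haσ

/-- Two neighbouring hypotheses differ by exactly `a` on the plateau, so the errors there add up to
at least `a` times its volume, while the condition on `I` keeps the second moment of the likelihood
ratio of the samples at most 2. -/
theorem two_point_humps (hσ : 0 < σ) (ha : 0 < a) (haσ : a ≤ σ) (hm : 0 < m)
    {k : Fin d → Fin m} (hI : ∫ x in cube d, hump a k x * hump a k x ≤ I)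
    (hn : (1 + I / σ ^ 2) ^ n ≤ 2) {fhat : Sample d n → E d → ℝ}
    (hfhat : Measurable (Function.uncurry fhat)) {S : Finset (Fin d → Fin m)} (hk : k ∉ S) :
    ENNReal.ofReal a * volume (plateau k) * 2⁻¹ ≤
      ∫⁻ z, (∫⁻ x in plateau k, ENNReal.ofReal |fhat z x - humps a S x|)
          ∂(Measure.pi fun _ : Fin n => law σ (humps a S)) +
      ∫⁻ z, (∫⁻ x in plateau k, ENNReal.ofReal |fhat z x - humps a (insert k S) x|)
          ∂(Measure.pi fun _ : Fin n => law σ (humps a (insert k S))) := by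
  have hf := continuous_humps a S
  have hg := continuous_hump a k
  have hfσ := abs_humps_le (σ := σ) ha haσ S
  have hgσ := abs_hump_le (σ := σ) ha haσ k
  have hfg := humps_mul_hump a hk
  have hins : humps a (insert k S) = fun x => humps a S x + hump a k x :=
    funext (humps_insert a hk)
  have hfgσ : ∀ x, |humps a S x + hump a k x| ≤ σ := fun x => by
    rw [← humps_insert a hk]; exact abs_humps_le ha haσ _ x
  have hP := isProbabilityMeasure_law hσ hf.measurable hfσ
  have hmeas : ∀ f : E d → ℝ, Measurable f → Measurable fun z : Sample d n =>
      ∫⁻ x in plateau k, ENNReal.ofReal |fhat z x - f x| := by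
    intro f hf
    refine Measurable.lintegral_prod_right' (ν := volume.restrict (plateau k))
      (f := fun p : Sample d n × E d => ENNReal.ofReal |fhat p.1 p.2 - f p.2|) ?_
    exact ((hfhat.sub (hf.comp measurable_snd)).abs).ennreal_ofReal
  have hL := measurable_prod_tilt n σ hg.measurable
  have e : (Measure.pi fun _ : Fin n => law σ (humps a (insert k S))) =
      (Measure.pi fun _ : Fin n => law σ (humps a S)).withDensity
        fun z => ∏ i, tilt σ (hump a k) (z i) := by
    rw [hins]; exact pi_law_add n hσ hf hg hfσ hgσ hfg hfgσ
  rw [e]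
  refine half_le_lintegral_add_of_sq_le hL (hmeas _ hf.measurable)
    (hmeas _ (continuous_humps a (insert k S)).measurable) ?_ ?_ fun z => ?_
  · rw [lintegral_pi_prod _ n (fun _ => tilt σ (hump a k)) fun _ => measurable_tilt σ hg.measurable,
      lintegral_tilt_eq_one hσ hf hg hfσ hgσ hfg]
    simp
  · simp_rw [← Finset.prod_mul_distrib]
    rw [lintegral_pi_prod _ n (fun _ w => tilt σ (hump a k) w * tilt σ (hump a k) w)
      fun _ => (measurable_tilt σ hg.measurable).mul (measurable_tilt σ hg.measurable),
      lintegral_tilt_mul_tilt hσ hf hg hg hfσ hgσ hgσ hfg hfg hfgσ, Finset.prod_const,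
      Finset.card_univ, Fintype.card_fin]
    have hnn : 0 ≤ ∫ x in cube d, hump a k x * hump a k x :=
      integral_nonneg fun x => mul_self_nonneg _
    have : (1 + (∫ x in cube d, hump a k x * hump a k x) / σ ^ 2) ^ n ≤ 2 := by
      refine le_trans ?_ hn
      gcongr
    have := ofReal_pow_le_ofReal (by positivity) this
    simpa using this
  · have hx : ∀ x ∈ plateau k, ENNReal.ofReal a ≤ ENNReal.ofReal |fhat z x - humps a S x| +
        ENNReal.ofReal |fhat z x - humps a (insert k S) x| := by
      intro x hx
      rw [← ENNReal.ofReal_add (abs_nonneg _) (abs_nonneg _)]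
      refine ENNReal.ofReal_le_ofReal ?_
      rw [humps_insert a hk, hump_of_mem_plateau hm a hx]
      have h1 := le_abs_self (fhat z x - humps a S x)
      have h2 := neg_abs_le (fhat z x - (humps a S x + a))
      linarith
    have hz : Measurable fun x => ENNReal.ofReal |fhat z x - humps a S x| :=
      (((hfhat.comp (measurable_const.prodMk measurable_id)).sub
        hf.measurable).abs).ennreal_ofReal
    rw [← lintegral_add_left hz, ← setLIntegral_const]
    exact setLIntegral_mono' (measurableSet_plateau k) hx

/-- Assouad's lower bound for the integrated absolute error over the family of bump sums. -/
theorem assouad_humps (hσ : 0 < σ) (ha : 0 < a) (haσ : a ≤ σ) (hm : 0 < m)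
    (hI : ∀ k : Fin d → Fin m, ∫ x in cube d, hump a k x * hump a k x ≤ I)
    (hn : (1 + I / σ ^ 2) ^ n ≤ 2) {fhat : Sample d n → E d → ℝ}
    (hfhat : Measurable (Function.uncurry fhat)) {R : ℝ≥0∞}
    (hR : ∀ S : Finset (Fin d → Fin m),
      ∫⁻ z, (∫⁻ x in cube d, ENNReal.ofReal |fhat z x - humps a S x|)
          ∂(Measure.pi fun _ : Fin n => law σ (humps a S)) ≤ R) :
    ENNReal.ofReal (a * (1 / 4) * (1 / 4) ^ d) * volume (Metric.ball (0 : E d) 1) ≤ R := by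
  classical
  let T : (Fin d → Fin m) → Finset (Fin d → Fin m) → ℝ≥0∞ := fun k S =>
    ∫⁻ z, (∫⁻ x in plateau k, ENNReal.ofReal |fhat z x - humps a S x|)
          ∂(Measure.pi fun _ : Fin n => law σ (humps a S))
  have hsum : ∀ S, ∑ k, T k S ≤ R := by
    intro S
    refine le_trans ?_ (hR S)
    have hmeas : ∀ k : Fin d → Fin m, Measurable fun z : Sample d n =>
        ∫⁻ x in plateau k, ENNReal.ofReal |fhat z x - humps a S x| := by
      intro k
      refine Measurable.lintegral_prod_right' (ν := volume.restrict (plateau k))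
        (f := fun p : Sample d n × E d => ENNReal.ofReal |fhat p.1 p.2 - humps a S p.2|) ?_
      exact ((hfhat.sub ((continuous_humps a S).measurable.comp measurable_snd)).abs).ennreal_ofReal
    simp only [T]
    rw [← lintegral_finsetSum _ fun k _ => hmeas k]
    refine lintegral_mono fun z => ?_
    rw [← lintegral_biUnion_finset (fun k _ l _ hkl => plateau_pairwiseDisjoint hm hkl)
      (fun k _ => measurableSet_plateau k)]
    exact lintegral_mono_set (iUnion₂_subset fun k _ => plateau_subset_cube hm k)
  have hpair : ∀ k, (2 : ℝ≥0∞) ^ (Fintype.card (Fin d → Fin m) - 1) *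
      (ENNReal.ofReal a * volume (plateau k) * 2⁻¹) ≤ ∑ S, T k S := by
    intro k
    -- Pair each set `S` avoiding `k` with `insert k S`. There are `2 ^ (m ^ d - 1)` pairs.
    have hu : (Finset.univ : Finset (Finset (Fin d → Fin m))) =
        (insert k (Finset.univ.erase k)).powerset := by
      rw [Finset.insert_erase (Finset.mem_univ k), Finset.powerset_univ]
    have hk : k ∉ (Finset.univ.erase k : Finset (Fin d → Fin m)) := Finset.notMem_erase _ _
    rw [hu, Finset.sum_powerset_insert hk, ← Finset.sum_add_distrib]
    have : ∀ S ∈ (Finset.univ.erase k : Finset (Fin d → Fin m)).powerset,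
        ENNReal.ofReal a * volume (plateau k) * 2⁻¹ ≤ T k S + T k (insert k S) := by
      intro S hS
      exact two_point_humps hσ ha haσ hm (hI k) hn hfhat
        fun h => hk (Finset.mem_powerset.1 hS h)
    refine le_trans (le_of_eq ?_) (Finset.card_nsmul_le_sum _ _ _ this)
    rw [Finset.card_powerset, Finset.card_erase_of_mem (Finset.mem_univ k), Finset.card_univ,
      nsmul_eq_mul]
    push_cast
    rfl
  have hcard : Fintype.card (Fin d → Fin m) = m ^ d := by simp
  have hpos : 0 < m ^ d := pow_pos hm d
  set v := ENNReal.ofReal ((1 / 4 * (m : ℝ)⁻¹) ^ d) * volume (Metric.ball (0 : E d) 1) with hv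
  -- Double counting of the errors over cells and sets of bumps. The pairing costs one factor `1/2`
  -- and the two-point bound another, whence `a * (1/4)`; the `m ^ d` plateaus together have volume
  -- `(1/4) ^ d` times that of the unit ball.
  have hmain : (m ^ d : ℕ) * ((2 : ℝ≥0∞) ^ (m ^ d - 1) * (ENNReal.ofReal a * v * 2⁻¹)) ≤
      2 ^ (m ^ d) * R := by
    calc (m ^ d : ℕ) * ((2 : ℝ≥0∞) ^ (m ^ d - 1) * (ENNReal.ofReal a * v * 2⁻¹))
        = ∑ k : Fin d → Fin m, (2 : ℝ≥0∞) ^ (Fintype.card (Fin d → Fin m) - 1) *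
            (ENNReal.ofReal a * volume (plateau k) * 2⁻¹) := by
          simp_rw [volume_plateau, hcard]
          rw [Finset.sum_const, Finset.card_univ, hcard, nsmul_eq_mul]
      _ ≤ ∑ k, ∑ S, T k S := Finset.sum_le_sum fun k _ => hpair k
      _ = ∑ S, ∑ k, T k S := Finset.sum_comm
      _ ≤ ∑ S : Finset (Fin d → Fin m), R := Finset.sum_le_sum fun S _ => hsum S
      _ = 2 ^ (m ^ d) * R := by
          rw [Finset.sum_const, Finset.card_univ, Fintype.card_finset, hcard, nsmul_eq_mul]
          push_cast
          rfl
  have h2 : (2 : ℝ≥0∞) ^ (m ^ d) = 2 ^ (m ^ d - 1) * 2 := by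
    rw [← pow_succ, Nat.sub_add_cancel hpos]
  rw [h2, mul_assoc _ 2 R, mul_left_comm, ENNReal.mul_le_mul_iff_right (by simp) (by simp)] at hmain
  have hm' : (0 : ℝ) < m := by exact_mod_cast hm
  have e1 : ∀ V : ℝ≥0∞, ((m ^ d : ℕ) : ℝ≥0∞) * (ENNReal.ofReal a *
      (ENNReal.ofReal ((1 / 4 * (m : ℝ)⁻¹) ^ d) * V) * 2⁻¹) =
      2 * (ENNReal.ofReal (a * (1 / 4) * (1 / 4) ^ d) * V) := by
    intro V
    have e2 : ((m ^ d : ℕ) : ℝ≥0∞) = ENNReal.ofReal ((m : ℝ) ^ d) := by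
      rw [← Nat.cast_pow, ENNReal.ofReal_natCast]
    have e3 : (2 : ℝ≥0∞)⁻¹ = ENNReal.ofReal 2⁻¹ := by
      rw [ENNReal.ofReal_inv_of_pos (by norm_num)]; simp
    have e4 : (2 : ℝ≥0∞) = ENNReal.ofReal 2 := by simp
    rw [e2, e3, e4]
    have : ENNReal.ofReal ((m : ℝ) ^ d) * (ENNReal.ofReal a *
        (ENNReal.ofReal ((1 / 4 * (m : ℝ)⁻¹) ^ d) * V) *
        ENNReal.ofReal 2⁻¹) = (ENNReal.ofReal ((m : ℝ) ^ d) * ENNReal.ofReal a *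
        ENNReal.ofReal ((1 / 4 * (m : ℝ)⁻¹) ^ d) * ENNReal.ofReal 2⁻¹) * V := by ring
    rw [this, ← mul_assoc, ← ENNReal.ofReal_mul (by positivity),
      ← ENNReal.ofReal_mul (by positivity), ← ENNReal.ofReal_mul (by positivity),
      ← ENNReal.ofReal_mul (by positivity)]
    congr 2
    rw [mul_pow, inv_pow]
    field_simp
    ring
  rw [hv, e1, ENNReal.mul_le_mul_iff_right (by simp) (by simp)] at hmain
  exact hmain

/-- Lower bound for the maximal error at the cell centres over the family of single bumps, by
comparing the zero function with the uniform mixture of the bumps. -/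
theorem mixture_humps (hσ : 0 < σ) (ha : 0 < a) (haσ : a ≤ σ) (hm : 0 < m)
    (hI : ∀ k : Fin d → Fin m, ∫ x in cube d, hump a k x * hump a k x ≤ I)
    (hn : (1 + I / σ ^ 2) ^ n ≤ (m : ℝ) ^ d) {fhat : Sample d n → E d → ℝ}
    (hfhat : Measurable (Function.uncurry fhat)) {R : ℝ≥0∞}
    (hR : ∀ S : Finset (Fin d → Fin m),
      ∫⁻ z, ⨆ k : Fin d → Fin m,
          ENNReal.ofReal |fhat z (cellCenter k) - humps a S (cellCenter k)|
          ∂(Measure.pi fun _ : Fin n => law σ (humps a S)) ≤ R) :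
    ENNReal.ofReal (a / 4) ≤ R := by
  classical
  have h0 : humps a (∅ : Finset (Fin d → Fin m)) = fun _ => 0 := humps_empty a
  have hc0 : Continuous (fun _ : E d => (0 : ℝ)) := continuous_const
  have h0σ : ∀ x : E d, |(0 : ℝ)| ≤ σ := fun x => by simpa using hσ.le
  have hP := isProbabilityMeasure_law hσ (hc0.measurable) h0σ
  set μ : Measure (Sample d n) := Measure.pi fun _ : Fin n => law σ (fun _ : E d => (0 : ℝ)) with hμ
  have hcard : Fintype.card (Fin d → Fin m) = m ^ d := by simp
  have hpos : 0 < m ^ d := pow_pos hm d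
  set M : ℝ≥0∞ := ((m ^ d : ℕ) : ℝ≥0∞) with hM
  have hM0 : M ≠ 0 := by rw [hM]; exact_mod_cast hpos.ne'
  have hMt : M ≠ ⊤ := ENNReal.natCast_ne_top _
  let Λ : (Fin d → Fin m) → Sample d n → ℝ≥0∞ := fun k z => ∏ i, tilt σ (hump a k) (z i)
  have hΛ : ∀ k, Measurable (Λ k) := fun k =>
    measurable_prod_tilt n σ (continuous_hump a k).measurable
  have hΛ1 : ∀ k, ∫⁻ z, Λ k z ∂μ = 1 := by
    intro k
    simp only [Λ, hμ]
    rw [lintegral_pi_prod _ n (fun _ => tilt σ (hump a k))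
      fun _ => measurable_tilt σ (continuous_hump a k).measurable,
      lintegral_tilt_eq_one hσ hc0 (continuous_hump a k) h0σ (abs_hump_le ha haσ k) (by simp)]
    simp
  have hΛΛ : ∀ k l, ∫⁻ z, Λ k z * Λ l z ∂μ =
      ENNReal.ofReal (1 + (∫ x in cube d, hump a k x * hump a l x) / σ ^ 2) ^ n := by
    intro k l
    simp only [Λ, hμ]
    simp_rw [← Finset.prod_mul_distrib]
    rw [lintegral_pi_prod _ n (fun _ w => tilt σ (hump a k) w * tilt σ (hump a l) w)
      fun _ => (measurable_tilt σ (continuous_hump a k).measurable).mul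
        (measurable_tilt σ (continuous_hump a l).measurable),
      lintegral_tilt_mul_tilt hσ hc0 (continuous_hump a k) (continuous_hump a l) h0σ
        (abs_hump_le ha haσ k) (abs_hump_le ha haσ l) (by simp) (by simp)
        (fun x => by simpa using abs_hump_le ha haσ k x), Finset.prod_const,
      Finset.card_univ, Fintype.card_fin]
  -- The diagonal term is at most `M`; the `M - 1` others equal 1 since the bumps are disjoint.
  -- After division by `M²`, the mixture has second moment at most 2.
  have hbound : ∀ k, ∑ l, ∫⁻ z, Λ k z * Λ l z ∂μ ≤ 2 * M := by
    intro k
    have hle : ∀ l, ∫⁻ z, Λ k z * Λ l z ∂μ ≤ (if l = k then M else 0) + 1 := by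
      intro l
      rw [hΛΛ]
      by_cases hl : l = k
      · subst hl
        rw [if_pos rfl]
        refine le_trans ?_ le_self_add
        have hnn : 0 ≤ ∫ x in cube d, hump a l x * hump a l x :=
          integral_nonneg fun x => mul_self_nonneg _
        have : (1 + (∫ x in cube d, hump a l x * hump a l x) / σ ^ 2) ^ n ≤ (m : ℝ) ^ d := by
          refine le_trans ?_ hn
          gcongr
          exact hI l
        refine (ofReal_pow_le_ofReal (by positivity) this).trans (le_of_eq ?_)
        rw [hM, ← Nat.cast_pow, ENNReal.ofReal_natCast]
      · rw [if_neg hl]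
        have : ∀ x, hump a k x * hump a l x = 0 := hump_mul_hump a (Ne.symm hl)
        simp [this]
    refine (Finset.sum_le_sum fun l _ => hle l).trans (le_of_eq ?_)
    rw [Finset.sum_add_distrib, Finset.sum_ite_eq' Finset.univ k, if_pos (Finset.mem_univ k),
      Finset.sum_const, Finset.card_univ, hcard, nsmul_eq_mul, mul_one, two_mul]
  let L : Sample d n → ℝ≥0∞ := fun z => M⁻¹ * ∑ k, Λ k z
  have hmΛ : Measurable fun z => ∑ k, Λ k z := Finset.measurable_sum _ fun k _ => hΛ k
  have hL : Measurable L := hmΛ.const_mul _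
  have hL1 : ∫⁻ z, L z ∂μ = 1 := by
    simp only [L]
    rw [lintegral_const_mul _ hmΛ, lintegral_finsetSum _ fun k _ => hΛ k]
    simp_rw [hΛ1]
    rw [Finset.sum_const, Finset.card_univ, hcard, nsmul_eq_mul, mul_one,
      ENNReal.inv_mul_cancel hM0 hMt]
  have hL2 : ∫⁻ z, L z * L z ∂μ ≤ 2 := by
    have e : ∀ z, L z * L z = M⁻¹ * (M⁻¹ * ∑ k, ∑ l, Λ k z * Λ l z) := by
      intro z
      simp only [L]
      rw [← Finset.sum_mul_sum]; ring
    have hm2 : ∀ k, Measurable fun z => ∑ l, Λ k z * Λ l z := fun k =>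
      Finset.measurable_sum _ fun l _ => (hΛ k).mul (hΛ l)
    have hm3 : Measurable fun z => ∑ k, ∑ l, Λ k z * Λ l z :=
      Finset.measurable_sum _ fun k _ => hm2 k
    simp_rw [e]
    rw [lintegral_const_mul _ (hm3.const_mul _), lintegral_const_mul _ hm3,
      lintegral_finsetSum _ fun k _ => hm2 k]
    calc M⁻¹ * (M⁻¹ * ∑ k, ∫⁻ z, ∑ l, Λ k z * Λ l z ∂μ)
        ≤ M⁻¹ * (M⁻¹ * ∑ k : Fin d → Fin m, 2 * M) := by
          gcongr with k
          rw [lintegral_finsetSum (f := fun l z => Λ k z * Λ l z) _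
            fun l _ => (hΛ k).mul (hΛ l)]
          exact hbound k
      _ = (M⁻¹ * M) * (M⁻¹ * M) * 2 := by
          rw [Finset.sum_const, Finset.card_univ, hcard, nsmul_eq_mul, ← hM]; ring
      _ = 2 := by rw [ENNReal.inv_mul_cancel hM0 hMt]; simp
  have hzm : ∀ x : E d, Measurable fun z : Sample d n => fhat z x := fun x =>
    hfhat.comp (measurable_id.prodMk measurable_const)
  let A : Sample d n → ℝ≥0∞ := fun z => ⨆ k : Fin d → Fin m,
    ENNReal.ofReal |fhat z (cellCenter k)|
  have hA : Measurable A := Measurable.iSup fun k => (hzm _).abs.ennreal_ofReal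
  -- Truncated subtraction makes `a ≤ A + B` automatic. Under any single bump `k`, `B` is at most
  -- the error at the centre `k`, where the function equals `a`, so the same `B` serves for all
  -- components of the mixture.
  let B : Sample d n → ℝ≥0∞ := fun z => ENNReal.ofReal a - A z
  have hB : Measurable B := measurable_const.sub hA
  have hmain := half_le_lintegral_add_of_sq_le hL hA hB hL1 hL2 (s := ENNReal.ofReal a)
    fun z => le_add_tsub
  have hAR : ∫⁻ z, A z ∂μ ≤ R := by
    have := hR ∅
    rw [h0] at this
    simpa only [sub_zero] using this
  have hBk : ∀ k, ∫⁻ z, (Λ k * B) z ∂μ ≤ R := by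
    intro k
    have e : (Measure.pi fun _ : Fin n => law σ (humps a {k})) = μ.withDensity (Λ k) := by
      have := pi_law_add n hσ hc0 (continuous_hump a k) h0σ (abs_hump_le ha haσ k) (by simp)
        (fun x => by simpa using abs_hump_le ha haσ k x)
      rw [humps_singleton]
      simpa only [zero_add] using this
    have := hR {k}
    rw [e, humps_singleton] at this
    rw [← lintegral_withDensity_eq_lintegral_mul _ (hΛ k) hB]
    refine le_trans (lintegral_mono fun z => ?_) this
    refine le_trans ?_ (le_iSup _ k)
    rw [hump_of_mem_plateau hm a (cellCenter_mem_plateau k)]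
    simp only [B]
    rw [tsub_le_iff_right]
    refine le_trans ?_ (add_le_add_right (le_iSup (fun k : Fin d → Fin m =>
      ENNReal.ofReal |fhat z (cellCenter k)|) k) _)
    rw [← ENNReal.ofReal_add (abs_nonneg _) (abs_nonneg _)]
    refine ENNReal.ofReal_le_ofReal ?_
    have h1 := le_abs_self (fhat z (cellCenter k))
    have h2 := neg_abs_le (fhat z (cellCenter k) - a)
    linarith
  have hBR : ∫⁻ z, B z ∂(μ.withDensity L) ≤ R := by
    rw [lintegral_withDensity_eq_lintegral_mul _ hL hB]
    have e : ∀ z, (L * B) z = M⁻¹ * ∑ k, (Λ k * B) z := by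
      intro z
      simp only [L, Pi.mul_apply]
      rw [mul_assoc, Finset.sum_mul]
    simp_rw [e]
    rw [lintegral_const_mul _ (Finset.measurable_sum _ fun k _ => (hΛ k).mul hB),
      lintegral_finsetSum _ fun k _ => (hΛ k).mul hB]
    calc M⁻¹ * ∑ k, ∫⁻ z, (Λ k * B) z ∂μ ≤ M⁻¹ * ∑ k : Fin d → Fin m, R := by
          gcongr with k
          exact hBk k
      _ = R := by
          rw [Finset.sum_const, Finset.card_univ, hcard, nsmul_eq_mul, ← mul_assoc, ← hM,
            ENNReal.inv_mul_cancel hM0 hMt, one_mul]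
  have h2R : ENNReal.ofReal a * 2⁻¹ ≤ 2 * R := by
    rw [two_mul]; exact hmain.trans (add_le_add hAR hBR)
  have e5 : ENNReal.ofReal a * 2⁻¹ = 2 * ENNReal.ofReal (a / 4) := by
    have e3 : (2 : ℝ≥0∞)⁻¹ = ENNReal.ofReal 2⁻¹ := by
      rw [ENNReal.ofReal_inv_of_pos (by norm_num)]; simp
    have e4 : (2 : ℝ≥0∞) = ENNReal.ofReal 2 := by simp
    rw [e3, e4, ← ENNReal.ofReal_mul ha.le, ← ENNReal.ofReal_mul (by norm_num)]
    congr 1; ring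
  rw [e5, ENNReal.mul_le_mul_iff_right (by simp) (by simp)] at h2R
  exact h2R

end Assouad

/-! ### Choice of amplitude and resolution, and the nonparametric rates -/

theorem exists_small_amplitude {L₀ σ V κ : ℝ} (hL₀ : 0 < L₀) (hσ : 0 < σ) (hV : 0 ≤ V)
    (hκ : 0 < κ) : ∃ L : ℝ, 0 < L ∧ L ≤ L₀ ∧ L ≤ σ ∧ L ^ 2 * V / σ ^ 2 ≤ κ := by
  have hs : 0 < σ * √(κ / (V + 1)) := by positivity
  refine ⟨min L₀ (min σ (σ * √(κ / (V + 1)))), lt_min hL₀ (lt_min hσ hs), min_le_left _ _,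
    (min_le_right _ _).trans (min_le_left _ _), ?_⟩
  set L := min L₀ (min σ (σ * √(κ / (V + 1))))
  have hL : 0 < L := lt_min hL₀ (lt_min hσ hs)
  have hLs : L ≤ σ * √(κ / (V + 1)) := (min_le_right _ _).trans (min_le_right _ _)
  have h1 : L ^ 2 ≤ σ ^ 2 * (κ / (V + 1)) := by
    have := pow_le_pow_left₀ hL.le hLs 2
    rwa [mul_pow, Real.sq_sqrt (by positivity)] at this
  rw [div_le_iff₀ (by positivity)]
  calc L ^ 2 * V ≤ σ ^ 2 * (κ / (V + 1)) * V := by gcongr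
    _ = κ * σ ^ 2 * (V / (V + 1)) := by ring
    _ ≤ κ * σ ^ 2 * 1 := by
      gcongr
      rw [div_le_one (by positivity)]; linarith
    _ = _ := mul_one _

/-- The resolution `m` adapted to an effective sample size `x`. -/
theorem resolution_bounds {x β : ℝ} {d : ℕ} (hx : 1 ≤ x) (hβ : 0 < β) :
    ∃ m : ℕ, 0 < m ∧ ((m : ℝ)⁻¹) ^ (2 * β + d) ≤ x⁻¹ ∧
      2 ^ (-β) * x ^ (-β / (2 * β + d)) ≤ ((m : ℝ)⁻¹) ^ β ∧
      x ^ ((d : ℝ) / (2 * β + d)) ≤ (m : ℝ) ^ d := by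
  have hx0 : 0 < x := by linarith
  have hγ : 0 < 2 * β + d := by positivity
  -- Here `t ^ (2β + d) = x` balances information against sample size. Rounding up costs at most a
  -- factor 2 because `t ≥ 1`, whence the constant `2 ^ (-β)`.
  set t : ℝ := x ^ (1 / (2 * β + d)) with ht
  have ht1 : 1 ≤ t := Real.one_le_rpow hx (by positivity)
  have ht0 : 0 < t := by linarith
  have hm1 : t ≤ ⌈t⌉₊ := Nat.le_ceil t
  have hm0 : (0 : ℝ) < ⌈t⌉₊ := by linarith
  have hm2 : (⌈t⌉₊ : ℝ) ≤ 2 * t := by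
    have := Nat.ceil_lt_add_one ht0.le; linarith
  have htγ : t ^ (2 * β + d) = x := by
    rw [ht, ← Real.rpow_mul hx0.le, one_div, inv_mul_cancel₀ hγ.ne', Real.rpow_one]
  refine ⟨⌈t⌉₊, by exact_mod_cast hm0, ?_, ?_, ?_⟩
  · rw [Real.inv_rpow hm0.le, ← htγ]
    exact inv_anti₀ (Real.rpow_pos_of_pos ht0 _) (Real.rpow_le_rpow ht0.le hm1 hγ.le)
  · have : x ^ (-β / (2 * β + d)) = t ^ (-β) := by
      rw [ht, ← Real.rpow_mul hx0.le]; congr 1; field_simp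
    rw [this, ← Real.mul_rpow (by norm_num) ht0.le, Real.inv_rpow hm0.le, ← Real.rpow_neg hm0.le]
    exact Real.rpow_le_rpow_of_nonpos hm0 hm2 (by linarith)
  · have : x ^ ((d : ℝ) / (2 * β + d)) = t ^ d := by
      rw [ht, ← Real.rpow_natCast, ← Real.rpow_mul hx0.le]; congr 1; field_simp
    rw [this]
    exact pow_le_pow_left₀ ht0.le hm1 d

theorem one_add_pow_le_exp {u v : ℝ} {n : ℕ} (hu : 0 ≤ u) (h : n * u ≤ v) :
    (1 + u) ^ n ≤ Real.exp v := by
  calc (1 + u) ^ n ≤ (Real.exp u) ^ n := by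
        gcongr
        rw [add_comm]; exact Real.add_one_le_exp u
    _ = Real.exp (n * u) := (Real.exp_nat_mul u n).symm
    _ ≤ _ := Real.exp_le_exp.2 h

/-- The information bound for a bump of amplitude `L * m⁻¹ ^ β`. -/
theorem information_le {d m n : ℕ} {L β σ V κ x : ℝ} (hm : 0 < m) (hσ : 0 < σ)
    (hV : 0 ≤ V) (hκ : L ^ 2 * V / σ ^ 2 ≤ κ)
    (hmx : ((m : ℝ)⁻¹) ^ (2 * β + d) ≤ x⁻¹) :
    n * ((L * ((m : ℝ)⁻¹) ^ β) ^ 2 * (((m : ℝ)⁻¹) ^ d * V) / σ ^ 2) ≤ κ * (n / x) := by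
  have hm' : (0 : ℝ) < m := by exact_mod_cast hm
  have hh : 0 < (m : ℝ)⁻¹ := inv_pos.2 hm'
  have e : ((m : ℝ)⁻¹) ^ (2 * β + d) = (((m : ℝ)⁻¹) ^ β) ^ 2 * ((m : ℝ)⁻¹) ^ d := by
    rw [Real.rpow_add hh, Real.rpow_natCast, mul_comm 2 β, Real.rpow_mul hh.le]
    norm_cast
  have hκ0 : 0 ≤ L ^ 2 * V / σ ^ 2 := by positivity
  calc n * ((L * ((m : ℝ)⁻¹) ^ β) ^ 2 * (((m : ℝ)⁻¹) ^ d * V) / σ ^ 2)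
      = n * (L ^ 2 * V / σ ^ 2) * ((m : ℝ)⁻¹) ^ (2 * β + d) := by rw [e]; ring
    _ ≤ n * κ * x⁻¹ := by 
      gcongr
      exact mul_nonneg n.cast_nonneg (hκ0.trans hκ)
    _ = κ * (n / x) := by rw [div_eq_mul_inv]; ring

/-- The nonparametric lower bound for the integrated absolute error. -/
theorem nonparametric_lower_bound (d : ℕ) {β C σ : ℝ} (hβ : 0 < β) (hC : 0 < C) (hσ : 0 < σ) :
    ∃ c : ℝ, 0 < c ∧ ∀ n : ℕ, 1 ≤ n → ∀ fhat : Sample d n → E d → ℝ,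
      Measurable (Function.uncurry fhat) → ∀ R : ℝ≥0∞,
      (∀ f : E d → ℝ, Continuous f → (∀ x, |f x| ≤ σ) → f ∈ HolderClass d β C →
        ∫⁻ z, (∫⁻ x in cube d, ENNReal.ofReal |fhat z x - f x|)
          ∂(Measure.pi fun _ : Fin n => law σ f) ≤ R) →
      ENNReal.ofReal (c * (n : ℝ) ^ (-β / (2 * β + d))) ≤ R := by
  obtain ⟨L₀, hL₀, hH⟩ := exists_humps_mem_holderClass d hβ hC
  have hVt : volume (Metric.ball (0 : E d) 1) ≠ ⊤ := measure_ball_lt_top.ne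
  have hV : 0 < (volume (Metric.ball (0 : E d) 1)).toReal :=
    ENNReal.toReal_pos (Metric.measure_ball_pos _ _ one_pos).ne' hVt
  set V := (volume (Metric.ball (0 : E d) 1)).toReal with hVdef
  -- With total information at most `log 2`, the second moment of the likelihood ratio is at most
  -- `exp (log 2) = 2`.
  obtain ⟨L, hL, hLL₀, hLσ, hLκ⟩ := exists_small_amplitude (κ := Real.log 2) hL₀ hσ hV.le
    (Real.log_pos (by norm_num))
  refine ⟨L * 2 ^ (-β) * ((1 / 4) * (1 / 4) ^ d * V), by positivity, fun n hn fhat hfhat R hR => ?_⟩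
  have hn' : (1 : ℝ) ≤ n := by exact_mod_cast hn
  obtain ⟨m, hm, hm1, hm2, -⟩ := resolution_bounds (d := d) hn' hβ
  have hm' : (1 : ℝ) ≤ m := by exact_mod_cast hm
  have hh : 0 < (m : ℝ)⁻¹ := by positivity
  set a : ℝ := L * ((m : ℝ)⁻¹) ^ β with ha
  have ha0 : 0 < a := by positivity
  have haσ : a ≤ σ := (mul_le_of_le_one_right hL.le
    (Real.rpow_le_one hh.le (inv_le_one_of_one_le₀ hm') hβ.le)).trans hLσ
  have hI := information_le (n := n) (β := β) hm hσ hV.le hLκ hm1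
  rw [div_self (by linarith), mul_one] at hI
  have hpow := one_add_pow_le_exp (by positivity) hI
  rw [Real.exp_log (by norm_num)] at hpow
  have := assouad_humps hσ ha0 haσ hm (integral_hump_sq_le hm a) hpow hfhat (R := R) fun S =>
    hR _ (continuous_humps a S) (abs_humps_le ha0 haσ S) (hH L hL.le hLL₀ m hm S)
  refine le_trans ?_ this
  rw [← ENNReal.ofReal_toReal hVt, ← hVdef, ← ENNReal.ofReal_mul (by positivity)]
  refine ENNReal.ofReal_le_ofReal ?_
  calc L * 2 ^ (-β) * ((1 / 4) * (1 / 4) ^ d * V) * (n : ℝ) ^ (-β / (2 * β + d))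
      = L * (2 ^ (-β) * (n : ℝ) ^ (-β / (2 * β + d))) * ((1 / 4) * (1 / 4) ^ d * V) := by ring
    _ ≤ L * ((m : ℝ)⁻¹) ^ β * ((1 / 4) * (1 / 4) ^ d * V) := by gcongr
    _ = a * (1 / 4) * (1 / 4) ^ d * V := by rw [ha]; ring

/-- Apply `log y ≤ y - 1` at `y = √x / 2`; the remaining constant `2 log 2 - 2` is negative. -/
theorem log_le_sqrt {x : ℝ} (hx : 0 < x) : Real.log x ≤ √x := by
  have hs : 0 < √x := Real.sqrt_pos.2 hx
  have h1 : Real.log x = 2 * Real.log √x := by rw [Real.log_sqrt hx.le]; ring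
  have h2 := Real.log_le_sub_one_of_pos (half_pos hs)
  rw [Real.log_div hs.ne' (by norm_num)] at h2
  have h3 := Real.log_two_lt_d9
  linarith

/-- The nonparametric lower bound for the error in the uniform norm. -/
theorem nonparametric_lower_bound_sup (d : ℕ) (hd : 0 < d) {β C σ : ℝ} (hβ : 0 < β) (hC : 0 < C)
    (hσ : 0 < σ) :
    ∃ c : ℝ, 0 < c ∧ ∀ n : ℕ, 3 ≤ n → ∀ fhat : Sample d n → E d → ℝ,
      Measurable (Function.uncurry fhat) → ∀ R : ℝ≥0∞,
      (∀ f : E d → ℝ, Continuous f → (∀ x, |f x| ≤ σ) → f ∈ HolderClass d β C →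
        ∫⁻ z, (⨆ x ∈ cube d, ENNReal.ofReal |fhat z x - f x|)
          ∂(Measure.pi fun _ : Fin n => law σ f) ≤ R) →
      ENNReal.ofReal (c * ((n : ℝ) / Real.log n) ^ (-β / (2 * β + d))) ≤ R := by
  obtain ⟨L₀, hL₀, hH⟩ := exists_humps_mem_holderClass d hβ hC
  have hd' : (0 : ℝ) < d := by exact_mod_cast hd
  have hγ : 0 < 2 * β + d := by positivity
  -- The total information is at most `κ log n`, so the second moment is at most `n ^ κ = (√n) ^ (d
  -- / (2β + d))`. As `√n ≤ n / log n`, this does not exceed the number of cells.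
  obtain ⟨L, hL, hLL₀, hLσ, hLκ⟩ := exists_small_amplitude (κ := d / (2 * β + d) / 2) hL₀ hσ
    (ENNReal.toReal_nonneg (a := volume (Metric.ball (0 : E d) 1))) (by positivity)
  refine ⟨L * 2 ^ (-β) * (1 / 4), by positivity, fun n hn fhat hfhat R hR => ?_⟩
  have hn' : (3 : ℝ) ≤ n := by exact_mod_cast hn
  have hn0 : (0 : ℝ) < n := by linarith
  have hlog : 0 < Real.log n := Real.log_pos (by linarith)
  have hsqrt : √(n : ℝ) ≤ n / Real.log n := by
    rw [le_div_iff₀ hlog]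
    calc √(n : ℝ) * Real.log n ≤ √(n : ℝ) * √(n : ℝ) := by
          gcongr; exact log_le_sqrt hn0
      _ = n := Real.mul_self_sqrt hn0.le
  have hx1 : 1 ≤ (n : ℝ) / Real.log n := le_trans (Real.one_le_sqrt.2 (by linarith)) hsqrt
  obtain ⟨m, hm, hm1, hm2, hm3⟩ := resolution_bounds (d := d) hx1 hβ
  have hm' : (1 : ℝ) ≤ m := by exact_mod_cast hm
  have hh : 0 < (m : ℝ)⁻¹ := by positivity
  set a : ℝ := L * ((m : ℝ)⁻¹) ^ β with ha
  have ha0 : 0 < a := by positivity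
  have haσ : a ≤ σ := (mul_le_of_le_one_right hL.le
    (Real.rpow_le_one hh.le (inv_le_one_of_one_le₀ hm') hβ.le)).trans hLσ
  have hI := information_le (n := n) (β := β) hm hσ ENNReal.toReal_nonneg hLκ hm1
  have hpow := (one_add_pow_le_exp (by positivity) hI).trans (c := (m : ℝ) ^ d) <| by
    refine le_trans (le_of_eq ?_) ((Real.rpow_le_rpow (Real.sqrt_nonneg _) hsqrt
      (by positivity : 0 ≤ (d : ℝ) / (2 * β + d))).trans hm3)
    rw [div_div_cancel₀ hn0.ne', Real.sqrt_eq_rpow, ← Real.rpow_mul hn0.le,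
      Real.rpow_def_of_pos hn0]
    congr 1; ring
  have := mixture_humps hσ ha0 haσ hm (integral_hump_sq_le hm a) hpow hfhat (R := R) fun S =>
    le_trans (lintegral_mono fun z => iSup_le fun k =>
      le_iSup₂_of_le (cellCenter k) (plateau_subset_cube hm k (cellCenter_mem_plateau k)) le_rfl)
    (hR _ (continuous_humps a S) (abs_humps_le ha0 haσ S) (hH L hL.le hLL₀ m hm S))
  refine le_trans (ENNReal.ofReal_le_ofReal ?_) this
  calc L * 2 ^ (-β) * (1 / 4) * ((n : ℝ) / Real.log n) ^ (-β / (2 * β + d))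
      = L * (2 ^ (-β) * ((n : ℝ) / Real.log n) ^ (-β / (2 * β + d))) / 4 := by ring
    _ ≤ L * ((m : ℝ)⁻¹) ^ β / 4 := by gcongr

/-! ### Geometry of the attacks -/

theorem zero_mem_cube (d : ℕ) : (0 : E d) ∈ cube d := fun i => by simp

theorem norm_sub_le_sqrt {d : ℕ} {x y : E d} (hx : x ∈ cube d) (hy : y ∈ cube d) :
    ‖x - y‖ ≤ √d := by
  rw [EuclideanSpace.norm_eq]
  refine Real.sqrt_le_sqrt ?_
  have : ∀ i ∈ (Finset.univ : Finset (Fin d)), ‖(x - y) i‖ ^ 2 ≤ 1 := by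
    intro i _
    have h1 := hx i
    have h2 := hy i
    rw [mem_Icc] at h1 h2
    rw [sq_le_one_iff_abs_le_one, abs_norm, Real.norm_eq_abs, abs_le, PiLp.sub_apply]
    constructor <;> linarith [h1.1, h1.2, h2.1, h2.2]
  simpa using Finset.sum_le_sum this

theorem IsAttack.nonneg {d : ℕ} {A : E d → Set (E d)} {r : ℝ} (h : IsAttack A r) : 0 ≤ r :=
  h.magnitude.1 ⟨0, zero_mem_cube d, 0, h.mem_self 0 (zero_mem_cube d), by simp⟩

theorem IsAttack.le_sqrt {d : ℕ} {A : E d → Set (E d)} {r : ℝ} (h : IsAttack A r) : r ≤ √d := by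
  refine h.magnitude.2 ?_
  rintro t ⟨x, hx, x', hx', rfl⟩
  exact norm_sub_le_sqrt (h.subset x hx hx') hx

/-- The direction `v` is nonzero, so a point of the line determines its parameter `k` and lies in
the truncated segment as soon as `k` satisfies both bounds. -/
theorem IsSODA.smul_add_mem {d : ℕ} {cl cu : ℝ} {v : E d} {r : ℝ} {A : E d → Set (E d)}
    (h : IsSODA cl cu v r A) {x : E d} (hx : x ∈ cube d) {k : ℝ}
    (hk1 : -(cl * r) ≤ k) (hk2 : k ≤ cu * r) (hkx : k • v + x ∈ cube d) : k • v + x ∈ A x := by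
  obtain ⟨kmin, kmax, kmin', kmax', h0, h1, hseg, hA, rfl, rfl⟩ := h.segment x hx
  have hv : v ≠ 0 := by
    intro hv
    have := h.unit
    simp [hv] at this
  have hmem : k • v + x ∈ (fun k : ℝ => k • v + x) '' Icc kmin kmax := by
    rw [hseg]; exact ⟨⟨k, rfl⟩, hkx⟩
  obtain ⟨k', hk', he⟩ := hmem
  have : k' = k := by
    have h2 : k' • v = k • v := add_right_cancel he
    exact smul_left_injective ℝ hv h2
  subst this
  have : k' • v + x ∈ (fun k : ℝ => k • v + x) ''
      Icc (max kmin (-(cl * r))) (min kmax (cu * r)) :=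
    ⟨k', ⟨max_le hk'.1 hk1, le_min hk'.2 hk2⟩, rfl⟩
  rw [hA] at this
  exact this.2

/-- A SODA contains a segment of length proportional to `r` in one fixed direction. -/
theorem exists_direction {d : ℕ} {cl cu r : ℝ} {A : E d → Set (E d)} (hcl : 0 ≤ cl) (hcu : 0 ≤ cu)
    (hA : A ∈ SODAClass d cl cu r) :
    IsAttack A r ∧ ∃ u : E d, ‖u‖ = 1 ∧ ∀ x ∈ cube d, ∀ k : ℝ, 0 ≤ k → k ≤ max cl cu * r →
      x + k • u ∈ cube d → x + k • u ∈ A x := by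
  obtain ⟨v, hv⟩ := hA
  have hr := hv.attack.nonneg
  refine ⟨hv.attack, ?_⟩
  -- Follow `v` or `-v`, whichever side has the larger constant; this is why `cl + cu > 0` suffices.
  rcases le_total cl cu with h | h
  · refine ⟨v, hv.unit, fun x hx k hk0 hk hkx => ?_⟩
    rw [max_eq_right h] at hk
    rw [add_comm] at hkx ⊢
    exact hv.smul_add_mem hx (le_trans (neg_nonpos.2 (mul_nonneg hcl hr)) hk0) hk hkx
  · refine ⟨-v, by rw [norm_neg]; exact hv.unit, fun x hx k hk0 hk hkx => ?_⟩
    rw [max_eq_left h] at hk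
    have e : x + k • -v = (-k) • v + x := by rw [smul_neg, neg_smul, add_comm]
    rw [e] at hkx ⊢
    exact hv.smul_add_mem hx (by linarith) (le_trans (neg_nonpos.2 hk0) (mul_nonneg hcu hr)) hkx

/-! ### Plane waves and their increments -/

/-- A plane wave in direction `u` of amplitude `L * h ^ β`, wave length of order `h` and
phase `θ`. -/
noncomputable def wave {d : ℕ} (L h β θ : ℝ) (u x : E d) : ℝ :=
  L * h ^ β * Real.sin (inner ℝ u (h⁻¹ • x) + θ)

theorem continuous_wave {d : ℕ} (L h β θ : ℝ) (u : E d) : Continuous (wave L h β θ u) := by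
  unfold wave; fun_prop

theorem wave_mem_holderClass {d : ℕ} {L h β C : ℝ} (θ : ℝ) {u : E d} (hu : ‖u‖ = 1) (hβ : 0 < β)
    (hL : 0 ≤ L) (hh : 0 < h) (hh1 : h ≤ 1) (hC : 3 * L ≤ C) :
    wave L h β θ u ∈ HolderClass d β C := by
  have hΦ : ContDiff ℝ ((⊤ : ℕ∞) : WithTop ℕ∞) fun y : E d => Real.sin (inner ℝ u y + θ) :=
    ((contDiff_const.inner ℝ contDiff_id).add contDiff_const).sin
  exact mem_holderClass_rescale hΦ hβ hL hh hh1 (K := 1)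
    (fun j _ y => norm_iteratedFDeriv_sin_inner_le hu.le θ j y) (by linarith)

theorem abs_wave_le {d : ℕ} {L h β : ℝ} (θ : ℝ) (u : E d) (hβ : 0 < β)
    (hL : 0 ≤ L) (hh : 0 < h) (hh1 : h ≤ 1) (x : E d) : |wave L h β θ u x| ≤ L := by
  have h1 : h ^ β ≤ 1 := Real.rpow_le_one hh.le hh1 hβ.le
  have h0 : 0 ≤ h ^ β := Real.rpow_nonneg hh.le _
  rw [wave, abs_mul, abs_of_nonneg (mul_nonneg hL h0)]
  calc L * h ^ β * |Real.sin _| ≤ L * 1 * 1 := by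
        gcongr
        exact Real.abs_sin_le_one _
    _ = L := by ring

/-- By sum-to-product the two differences are `2 sin (τ/2)` times `|cos w|` and `|sin w|`, whose sum
is at least 1; moreover `sin (τ/2) ≥ τ/4` on this range. -/
theorem half_le_abs_sin_sub_add_abs_cos_sub {s τ : ℝ} (hτ : 0 ≤ τ) (hτ1 : τ ≤ 1) :
    τ / 2 ≤ |Real.sin (s + τ) - Real.sin s| + |Real.cos (s + τ) - Real.cos s| := by
  rcases hτ.eq_or_lt with rfl | hτ
  · simp
  have hy := Real.sin_gt_sub_cube (x := τ / 2) (by linarith)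
  have hs : τ / 4 ≤ Real.sin (τ / 2) := by nlinarith [sq_nonneg τ]
  rw [Real.sin_sub_sin, Real.cos_sub_cos]
  have e1 : (s + τ - s) / 2 = τ / 2 := by ring
  rw [e1, abs_mul, abs_mul, abs_mul, abs_mul, abs_of_pos (by linarith : 0 < Real.sin (τ / 2))]
  set w := (s + τ + s) / 2
  have h1 : 1 ≤ |Real.sin w| + |Real.cos w| := by
    have a1 := Real.sin_sq_add_cos_sq w
    have a2 := Real.abs_sin_le_one w
    have a3 := Real.abs_cos_le_one w
    have a4 := sq_abs (Real.sin w)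
    have a5 := sq_abs (Real.cos w)
    nlinarith [abs_nonneg (Real.sin w), abs_nonneg (Real.cos w)]
  have : |(2 : ℝ)| = 2 := by norm_num
  have : |(-2 : ℝ)| = 2 := by norm_num
  simp only [*]
  nlinarith

/-- One wave may have a vanishing increment near its crests. The sine and cosine phases do not
degenerate at the same point, so the bound is uniform in `x`. -/
theorem wave_increment {d : ℕ} {L h β δ : ℝ} {u : E d} (hu : ‖u‖ = 1) (hL : 0 ≤ L) (hh : 0 < h)
    (hδ : 0 ≤ δ) (hδh : δ ≤ h) (x : E d) :
    L * h ^ β * (δ / h / 2) ≤ |wave L h β 0 u (x + δ • u) - wave L h β 0 u x| +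
      |wave L h β (Real.pi / 2) u (x + δ • u) - wave L h β (Real.pi / 2) u x| := by
  have hLh : 0 ≤ L * h ^ β := mul_nonneg hL (Real.rpow_nonneg hh.le _)
  have e : inner ℝ u (h⁻¹ • (x + δ • u)) = inner ℝ u (h⁻¹ • x) + δ / h := by
    rw [smul_add, inner_add_right, smul_smul, real_inner_smul_right u u, real_inner_self_eq_norm_sq,
      hu]
    ring
  unfold wave
  rw [e, Real.sin_add_pi_div_two, Real.sin_add_pi_div_two, add_zero, add_zero, ← mul_sub, ← mul_sub,
    abs_mul (L * h ^ β), abs_mul (L * h ^ β), abs_of_nonneg hLh, ← mul_add]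
  exact mul_le_mul_of_nonneg_left (half_le_abs_sin_sub_add_abs_cos_sub (by positivity)
    ((div_le_one hh).2 hδh)) hLh

/-- For `β ≥ 1` a wave of unit scale already has increments of order `δ`; for `β ≤ 1` the scale `h =
δ` gives `δ ^ β`. -/
theorem exists_wave_scale {β δ : ℝ} (hδ : 0 < δ) (hδ1 : δ ≤ 1) :
    ∃ h : ℝ, 0 < h ∧ h ≤ 1 ∧ δ ≤ h ∧ h ^ β * (δ / h) = δ ^ min 1 β := by
  rcases le_total 1 β with h | h
  · exact ⟨1, one_pos, le_rfl, hδ1, by simp [min_eq_left h]⟩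
  · refine ⟨δ, hδ, hδ1, le_rfl, ?_⟩
    rw [min_eq_right h, div_self hδ.ne', mul_one]

/-! ### Lower bounds caused by the attack -/

/-- The centre of the cube. -/
noncomputable def cubeCenter (d : ℕ) : E d := WithLp.toLp 2 fun _ => (1 / 2 : ℝ)

theorem closedBall_cubeCenter_subset (d : ℕ) : Metric.closedBall (cubeCenter d) (1 / 2) ⊆ cube d := by
  apply ball_subset_cube
  intro i
  simp only [cubeCenter]
  norm_num

theorem add_smul_mem_cube {d : ℕ} {δ : ℝ} {u x : E d} (hu : ‖u‖ = 1) (hδ : 0 ≤ δ)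
    (hδ1 : δ ≤ 1 / 4) (hx : x ∈ Metric.closedBall (cubeCenter d) (1 / 4)) :
    x + δ • u ∈ cube d := by
  apply closedBall_cubeCenter_subset
  rw [Metric.mem_closedBall, dist_eq_norm] at hx ⊢
  have e : x + δ • u - cubeCenter d = (x - cubeCenter d) + δ • u := by abel
  rw [e]
  refine (norm_add_le _ _).trans ?_
  rw [norm_smul, hu, Real.norm_of_nonneg hδ]
  linarith

theorem mid_subset_cube (d : ℕ) : Metric.closedBall (cubeCenter d) (1 / 4) ⊆ cube d :=
  (Metric.closedBall_subset_closedBall (by norm_num)).trans (closedBall_cubeCenter_subset d)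

/-- The adversarial `L_q`-risk dominates the `q`-th power of an integrated measurable minorant of
the pointwise adversarial error. -/
theorem lintegral_rpow_le_advRisk {d n : ℕ} {q σ : ℝ} (hq : 1 ≤ q) (hσ : 0 < σ)
    {A : E d → Set (E d)} {fhat : Sample d n → E d → ℝ} {f : E d → ℝ} (hf : Continuous f)
    (hfσ : ∀ x, |f x| ≤ σ) {G : Sample d n → E d → ℝ≥0∞} (hG : Measurable (Function.uncurry G))
    (hGA : ∀ z, ∀ x ∈ cube d, ∃ x' ∈ A x, G z x ≤ ENNReal.ofReal |fhat z x' - f x|) :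
    (∫⁻ z, (∫⁻ x in cube d, G z x) ∂(Measure.pi fun _ : Fin n => law σ f)) ^ q ≤
      advRisk q A (law σ f) fhat f := by
  have hP := isProbabilityMeasure_law hσ hf.measurable hfσ
  have hq0 : 0 < q := by linarith
  set μ := (law σ f).prod (Measure.pi fun _ : Fin n => law σ f) with hμ
  have hG' : Measurable fun w : (E d × ℝ) × Sample d n => G w.2 w.1.1 :=
    hG.comp (measurable_snd.prodMk (measurable_fst.comp measurable_fst))
  have h1 : ∫⁻ z, (∫⁻ x in cube d, G z x) ∂(Measure.pi fun _ : Fin n => law σ f) =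
      ∫⁻ w, G w.2 w.1.1 ∂μ := by
    rw [hμ, lintegral_prod_symm _ hG'.aemeasurable]
    refine lintegral_congr fun z => ?_
    have hz : Measurable (G z) := hG.comp (measurable_const.prodMk measurable_id)
    rw [← map_fst_law hσ hf.measurable hfσ, lintegral_map hz measurable_fst]
  -- Jensen's inequality, as monotonicity of `L_p` norms on a probability space.
  have h2 : (∫⁻ w, G w.2 w.1.1 ∂μ) ^ q ≤ ∫⁻ w, (G w.2 w.1.1) ^ q ∂μ := by
    have := eLpNorm'_le_eLpNorm'_of_exponent_le one_pos hq μ hG'.aestronglyMeasurable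
    simp only [eLpNorm', enorm_eq_self, ENNReal.rpow_one, one_div, inv_one] at this
    rwa [ENNReal.le_rpow_inv_iff hq0] at this
  rw [h1]
  refine h2.trans (lintegral_mono_ae ?_)
  have hfst : ∀ᵐ w ∂μ, w.1.1 ∈ cube d :=
    Measure.quasiMeasurePreserving_fst.ae (ae_law_fst_mem hσ hf.measurable hfσ)
  filter_upwards [hfst] with w hw
  obtain ⟨x', hx', hle⟩ := hGA w.2 w.1.1 hw
  refine le_trans ?_ (le_iSup₂_of_le x' hx' le_rfl)
  rw [← ENNReal.ofReal_rpow_of_nonneg (abs_nonneg _) hq0.le]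
  exact ENNReal.rpow_le_rpow hle hq0.le

/-- In the average over the cube, an attack in direction `u` detects the increments of the
regression function. -/
theorem lintegral_increment_le {d : ℕ} {δ : ℝ} {u : E d} (hu : ‖u‖ = 1) (hδ : 0 ≤ δ)
    (hδ1 : δ ≤ 1 / 4) {F f : E d → ℝ} (hF : Measurable F) (hf : Measurable f) :
    ∫⁻ x in Metric.closedBall (cubeCenter d) (1 / 4), ENNReal.ofReal |f (x + δ • u) - f x| ≤
      2 * ∫⁻ x in cube d, max (ENNReal.ofReal |F x - f x|)
        ((Metric.closedBall (cubeCenter d) (1 / 4)).indicator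
          (fun x => ENNReal.ofReal |F (x + δ • u) - f x|) x) := by
  set B := Metric.closedBall (cubeCenter d) (1 / 4) with hB
  have hBm : MeasurableSet B := Metric.isClosed_closedBall.measurableSet
  have ht : Measurable fun x : E d => x + δ • u := measurable_id.add_const _
  have m1 : Measurable fun x => ENNReal.ofReal |F (x + δ • u) - f x| :=
    ((hF.comp ht).sub hf).abs.ennreal_ofReal
  have m2 : Measurable fun x => ENNReal.ofReal |F x - f x| := (hF.sub hf).abs.ennreal_ofReal
  have e1 : ∫⁻ x in B, ENNReal.ofReal |f (x + δ • u) - f x| ≤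
      (∫⁻ x in B, ENNReal.ofReal |F (x + δ • u) - f x|) +
        ∫⁻ x in B, ENNReal.ofReal |F (x + δ • u) - f (x + δ • u)| := by
    rw [← lintegral_add_left m1]
    refine lintegral_mono fun x => ?_
    rw [← ENNReal.ofReal_add (abs_nonneg _) (abs_nonneg _)]
    refine ENNReal.ofReal_le_ofReal ?_
    rw [abs_sub_comm (F (x + δ • u)) (f (x + δ • u))]
    have := abs_sub_le (f (x + δ • u)) (F (x + δ • u)) (f x)
    linarith
  -- By translation invariance, the error at the shifted point is the ordinary error integrated over
  -- a translate of `B`, which stays inside the cube.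
  have e2 : ∫⁻ x in B, ENNReal.ofReal |F (x + δ • u) - f (x + δ • u)| ≤
      ∫⁻ x in cube d, ENNReal.ofReal |F x - f x| := by
    have := (measurePreserving_add_right (volume : Measure (E d)) (δ • u)).setLIntegral_comp_preimage
      (measurableSet_cube d) m2
    rw [← this]
    exact lintegral_mono_set fun x hx => add_smul_mem_cube hu hδ hδ1 hx
  have e3 : ∫⁻ x in B, ENNReal.ofReal |F (x + δ • u) - f x| ≤
      ∫⁻ x in cube d, B.indicator (fun x => ENNReal.ofReal |F (x + δ • u) - f x|) x := by
    rw [lintegral_indicator hBm, Measure.restrict_restrict hBm,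
      inter_eq_left.2 (mid_subset_cube d)]
  refine e1.trans ?_
  rw [two_mul]
  exact add_le_add (e3.trans (lintegral_mono fun x => le_max_right _ _))
    (e2.trans (lintegral_mono fun x => le_max_left _ _))

/-- The divisor `4√d` keeps the step at most `1/4`, since `r ≤ √d`; the shift of the central ball
then remains in the cube. -/
theorem exists_step {d : ℕ} (hd : 0 < d) {κ r : ℝ} (hκ : 0 < κ) (hκ1 : κ ≤ 1) (hr : 0 < r)
    (hrd : r ≤ √d) : 0 < κ * r / (4 * √d) ∧ κ * r / (4 * √d) ≤ 1 / 4 ∧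
      κ * r / (4 * √d) ≤ κ * r := by
  have hd1 : (1 : ℝ) ≤ √d := Real.one_le_sqrt.2 (by exact_mod_cast hd)
  have hκr : κ * r ≤ √d := (mul_le_of_le_one_left hr.le hκ1).trans hrd
  have hp : 0 < κ * r := mul_pos hκ hr
  refine ⟨by positivity, ?_, ?_⟩
  · rw [div_le_iff₀ (by positivity)]; linarith
  · rw [div_le_iff₀ (by positivity)]; nlinarith

/-- The adversarial part of the lower bound, for finite `q`. -/
theorem attack_lower_bound (d : ℕ) (hd : 0 < d) {β C σ κ : ℝ} (hβ : 0 < β) (hC : 0 < C)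
    (hσ : 0 < σ) (hκ : 0 < κ) (hκ1 : κ ≤ 1) :
    ∃ c : ℝ, 0 < c ∧ ∀ (n : ℕ) (r : ℝ), 0 < r → r ≤ √d → ∀ u : E d, ‖u‖ = 1 →
      ∀ A : E d → Set (E d), (∀ x ∈ cube d, x ∈ A x) →
      (∀ x ∈ cube d, ∀ k : ℝ, 0 ≤ k → k ≤ κ * r → x + k • u ∈ cube d → x + k • u ∈ A x) →
      ∀ fhat : Sample d n → E d → ℝ, Measurable (Function.uncurry fhat) → ∀ R : ℝ≥0∞,
      (∀ f : E d → ℝ, Continuous f → (∀ x, |f x| ≤ σ) → f ∈ HolderClass d β C →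
        ∀ G : Sample d n → E d → ℝ≥0∞, Measurable (Function.uncurry G) →
          (∀ z, ∀ x ∈ cube d, ∃ x' ∈ A x, G z x ≤ ENNReal.ofReal |fhat z x' - f x|) →
          ∫⁻ z, (∫⁻ x in cube d, G z x) ∂(Measure.pi fun _ : Fin n => law σ f) ≤ R) →
      ENNReal.ofReal (c * r ^ min 1 β) ≤ R := by
  -- The bound `σ` keeps the two-point weights nonnegative, and `C / 3` places the waves in the
  -- Hölder class.
  set L : ℝ := min σ (C / 3)
  have hL : 0 < L := lt_min hσ (by positivity)
  have hLC : 3 * L ≤ C := by have := min_le_right σ (C / 3); linarith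
  set B := Metric.closedBall (cubeCenter d) (1 / 4) with hB
  have hBm : MeasurableSet B := Metric.isClosed_closedBall.measurableSet
  have hBt : volume B ≠ ⊤ := measure_closedBall_lt_top.ne
  have hV : 0 < (volume B).toReal :=
    ENNReal.toReal_pos (Metric.measure_closedBall_pos _ _ (by norm_num)).ne' hBt
  have hsd : 0 < √(d : ℝ) := Real.sqrt_pos.2 (by exact_mod_cast hd)
  refine ⟨L * (κ / (4 * √d)) ^ min 1 β / 8 * (volume B).toReal, by positivity,
    fun n r hr hrd u hu A hAself hAu fhat hfhat R hR => ?_⟩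
  obtain ⟨hδ, hδ4, hδκ⟩ := exists_step hd hκ hκ1 hr hrd
  set δ := κ * r / (4 * √d) with hδdef
  obtain ⟨h, hh, hh1, hδh, hhδ⟩ := exists_wave_scale (β := β) hδ (by linarith)
  have hphase : ∀ θ, ∫⁻ x in B, ENNReal.ofReal
      |wave L h β θ u (x + δ • u) - wave L h β θ u x| ≤ 2 * R := by
    intro θ
    set f := wave L h β θ u with hf
    have hfc : Continuous f := continuous_wave L h β θ u
    have hfσ : ∀ x, |f x| ≤ σ := fun x =>
      (abs_wave_le θ u hβ hL.le hh hh1 x).trans (min_le_left _ _)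
    have hP := isProbabilityMeasure_law hσ hfc.measurable hfσ
    -- A measurable minorant of the adversarial error that uses only the two perturbed inputs `x`
    -- and `x + δu`, the second only for `x` in the central ball.
    let G : Sample d n → E d → ℝ≥0∞ := fun z x => max (ENNReal.ofReal |fhat z x - f x|)
      (B.indicator (fun x => ENNReal.ofReal |fhat z (x + δ • u) - f x|) x)
    have hG : Measurable (Function.uncurry G) := by
      refine Measurable.max (hfhat.sub (hfc.measurable.comp measurable_snd)).abs.ennreal_ofReal ?_
      have hsh : Measurable fun p : Sample d n × E d =>
          ENNReal.ofReal |fhat p.1 (p.2 + δ • u) - f p.2| :=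
        ((hfhat.comp (measurable_fst.prodMk (measurable_snd.add_const _))).sub
          (hfc.measurable.comp measurable_snd)).abs.ennreal_ofReal
      exact hsh.indicator (measurable_snd hBm)
    have hGR := hR f hfc hfσ (wave_mem_holderClass θ hu hβ hL.le hh hh1 hLC) G hG ?_
    · refine le_trans ?_ (mul_le_mul_right hGR 2)
      have hGm : Measurable fun z => ∫⁻ x in cube d, G z x := hG.lintegral_prod_right'
      rw [← lintegral_const_mul _ hGm]
      calc ∫⁻ x in B, ENNReal.ofReal |f (x + δ • u) - f x|
          = ∫⁻ _z, (∫⁻ x in B, ENNReal.ofReal |f (x + δ • u) - f x|)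
              ∂(Measure.pi fun _ : Fin n => law σ f) := by simp
        _ ≤ _ := lintegral_mono fun z => lintegral_increment_le hu hδ.le hδ4
            (hfhat.comp (measurable_const.prodMk measurable_id)) hfc.measurable
    · intro z x hx
      rcases max_choice (ENNReal.ofReal |fhat z x - f x|)
        (B.indicator (fun x => ENNReal.ofReal |fhat z (x + δ • u) - f x|) x) with hm | hm
      · exact ⟨x, hAself x hx, hm.le⟩
      · by_cases hxB : x ∈ B
        · refine ⟨x + δ • u, hAu x hx δ hδ.le hδκ (add_smul_mem_cube hu hδ.le hδ4 hxB), ?_⟩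
          rw [indicator_of_mem hxB] at hm
          simp only [G]
          rw [indicator_of_mem hxB, hm]
        · refine ⟨x, hAself x hx, ?_⟩
          simp only [G]
          rw [indicator_of_notMem hxB]
          simp
  have hsum : ENNReal.ofReal (L * h ^ β * (δ / h / 2)) * volume B ≤ 2 * R + 2 * R := by
    refine le_trans ?_ (add_le_add (hphase 0) (hphase (Real.pi / 2)))
    have hmeas : Measurable fun x => ENNReal.ofReal
        |wave L h β 0 u (x + δ • u) - wave L h β 0 u x| := by
      have hc := continuous_wave L h β 0 u
      exact ((hc.comp (continuous_id.add continuous_const)).sub hc).abs.measurable.ennreal_ofReal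
    rw [← lintegral_add_left hmeas, ← setLIntegral_const]
    refine lintegral_mono fun x => ?_
    rw [← ENNReal.ofReal_add (abs_nonneg _) (abs_nonneg _)]
    exact ENNReal.ofReal_le_ofReal (wave_increment hu hL.le hh hδ.le hδh x)
  have e1 : L * h ^ β * (δ / h / 2) = L * δ ^ min 1 β / 2 := by rw [← hhδ]; ring
  have e2 : δ ^ min 1 β = (κ / (4 * √d)) ^ min 1 β * r ^ min 1 β := by
    rw [← Real.mul_rpow (by positivity) hr.le, hδdef]; congr 1; ring
  rw [e1, ← ENNReal.ofReal_toReal hBt, ← ENNReal.ofReal_mul (by positivity)] at hsum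
  have e3 : L * δ ^ min 1 β / 2 * (volume B).toReal =
      4 * (L * (κ / (4 * √d)) ^ min 1 β / 8 * (volume B).toReal * r ^ min 1 β) := by
    rw [e2]; ring
  have e4 : 2 * R + 2 * R = ENNReal.ofReal 4 * R := by
    rw [← add_mul]; norm_num
  rw [e3, ENNReal.ofReal_mul (by norm_num), e4,
    ENNReal.mul_le_mul_iff_right (by simp) (by simp)] at hsum
  exact hsum

/-- The adversarial part of the lower bound in the uniform norm. -/
theorem attack_lower_bound_sup (d : ℕ) (hd : 0 < d) {β C σ κ : ℝ} (hβ : 0 < β) (hC : 0 < C)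
    (hσ : 0 < σ) (hκ : 0 < κ) (hκ1 : κ ≤ 1) :
    ∃ c : ℝ, 0 < c ∧ ∀ (n : ℕ) (r : ℝ), 0 < r → r ≤ √d → ∀ u : E d, ‖u‖ = 1 →
      ∀ A : E d → Set (E d), (∀ x ∈ cube d, x ∈ A x) →
      (∀ x ∈ cube d, ∀ k : ℝ, 0 ≤ k → k ≤ κ * r → x + k • u ∈ cube d → x + k • u ∈ A x) →
      ∀ (fhat : Sample d n → E d → ℝ) (R : ℝ≥0∞),
      (∀ f : E d → ℝ, Continuous f → (∀ x, |f x| ≤ σ) → f ∈ HolderClass d β C →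
        advRiskSup A (law σ f) fhat f ≤ R) →
      ENNReal.ofReal (c * r ^ min 1 β) ≤ R := by
  set L : ℝ := min σ (C / 3)
  have hL : 0 < L := lt_min hσ (by positivity)
  have hLC : 3 * L ≤ C := by have := min_le_right σ (C / 3); linarith
  have hsd : 0 < √(d : ℝ) := Real.sqrt_pos.2 (by exact_mod_cast hd)
  refine ⟨L * (κ / (4 * √d)) ^ min 1 β / 8, by positivity,
    fun n r hr hrd u hu A hAself hAu fhat R hR => ?_⟩
  obtain ⟨hδ, hδ4, hδκ⟩ := exists_step hd hκ hκ1 hr hrd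
  set δ := κ * r / (4 * √d) with hδdef
  obtain ⟨h, hh, hh1, hδh, hhδ⟩ := exists_wave_scale (β := β) hδ (by linarith)
  set x := cubeCenter d
  have hxB : x ∈ Metric.closedBall (cubeCenter d) (1 / 4) :=
    Metric.mem_closedBall_self (by norm_num)
  have hx : x ∈ cube d := mid_subset_cube d hxB
  have hy : x + δ • u ∈ cube d := add_smul_mem_cube hu hδ.le hδ4 hxB
  have hphase : ∀ θ, ENNReal.ofReal
      |wave L h β θ u (x + δ • u) - wave L h β θ u x| ≤ 2 * R := by
    intro θ
    set f := wave L h β θ u with hf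
    have hfc : Continuous f := continuous_wave L h β θ u
    have hfσ : ∀ x, |f x| ≤ σ := fun x =>
      (abs_wave_le θ u hβ hL.le hh hh1 x).trans (min_le_left _ _)
    have hP := isProbabilityMeasure_law hσ hfc.measurable hfσ
    have hfR := hR f hfc hfσ (wave_mem_holderClass θ hu hβ hL.le hh hh1 hLC)
    have hlow : ∀ z, ENNReal.ofReal |f (x + δ • u) - f x| * 2⁻¹ ≤
        ⨆ x ∈ cube d, ⨆ x' ∈ A x, ENNReal.ofReal |fhat z x' - f x| := by
      intro z
      -- The single value `fhat z (x + δ • u)` is compared with `f x`, through the attack at `x`,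
      -- and with `f (x + δ • u)`, through the trivial perturbation at the shifted point.
      set T := ⨆ x ∈ cube d, ⨆ x' ∈ A x, ENNReal.ofReal |fhat z x' - f x| with hT
      have t1 : ENNReal.ofReal |fhat z (x + δ • u) - f x| ≤ T :=
        le_iSup₂_of_le x hx (le_iSup₂_of_le (x + δ • u) (hAu x hx δ hδ.le hδκ hy) le_rfl)
      have t2 : ENNReal.ofReal |fhat z (x + δ • u) - f (x + δ • u)| ≤ T :=
        le_iSup₂_of_le (x + δ • u) hy (le_iSup₂_of_le (x + δ • u) (hAself _ hy) le_rfl)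
      rw [← div_eq_mul_inv]
      refine ENNReal.div_le_of_le_mul ?_
      rw [mul_two]
      refine le_trans ?_ (add_le_add t2 t1)
      rw [← ENNReal.ofReal_add (abs_nonneg _) (abs_nonneg _)]
      refine ENNReal.ofReal_le_ofReal ?_
      rw [abs_sub_comm (fhat z (x + δ • u)) (f (x + δ • u))]
      exact abs_sub_le _ _ _
    have hfin : ENNReal.ofReal |f (x + δ • u) - f x| * 2⁻¹ ≤ R := by
      refine le_trans ?_ hfR
      calc ENNReal.ofReal |f (x + δ • u) - f x| * 2⁻¹
          = ∫⁻ _z, ENNReal.ofReal |f (x + δ • u) - f x| * 2⁻¹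
              ∂(Measure.pi fun _ : Fin n => law σ f) := by simp
        _ ≤ _ := lintegral_mono hlow
    rw [← div_eq_mul_inv, ENNReal.div_le_iff (by simp) (by simp)] at hfin
    rwa [mul_comm]
  have hsum : ENNReal.ofReal (L * h ^ β * (δ / h / 2)) ≤ 2 * R + 2 * R := by
    refine le_trans ?_ (add_le_add (hphase 0) (hphase (Real.pi / 2)))
    rw [← ENNReal.ofReal_add (abs_nonneg _) (abs_nonneg _)]
    exact ENNReal.ofReal_le_ofReal (wave_increment hu hL.le hh hδ.le hδh x)
  have e2 : δ ^ min 1 β = (κ / (4 * √d)) ^ min 1 β * r ^ min 1 β := by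
    rw [← Real.mul_rpow (by positivity) hr.le, hδdef]; congr 1; ring
  have e3 : L * h ^ β * (δ / h / 2) =
      4 * (L * (κ / (4 * √d)) ^ min 1 β / 8 * r ^ min 1 β) := by
    calc L * h ^ β * (δ / h / 2) = L * (h ^ β * (δ / h)) / 2 := by ring
      _ = _ := by rw [hhδ, e2]; ring
  have e4 : 2 * R + 2 * R = ENNReal.ofReal 4 * R := by
    rw [← add_mul]; norm_num
  rw [e3, ENNReal.ofReal_mul (by norm_num), e4,
    ENNReal.mul_le_mul_iff_right (by simp) (by simp)] at hsum
  exact hsum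

/-! ### Combination of the two bounds -/

theorem ofReal_min_half_mul_add_le {c₁ c₂ u v : ℝ} {S : ℝ≥0∞} (hu : 0 ≤ u) (hv : 0 ≤ v)
    (h1 : ENNReal.ofReal (c₁ * u) ≤ S) (h2 : ENNReal.ofReal (c₂ * v) ≤ S) :
    ENNReal.ofReal (min c₁ c₂ / 2 * (u + v)) ≤ S := by
  refine le_trans (ENNReal.ofReal_le_ofReal (q := max (c₁ * u) (c₂ * v)) ?_) ?_
  · have := mul_le_mul_of_nonneg_right (min_le_left c₁ c₂) hu
    have := mul_le_mul_of_nonneg_right (min_le_right c₁ c₂) hv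
    have := le_max_left (c₁ * u) (c₂ * v)
    have := le_max_right (c₁ * u) (c₂ * v)
    linarith
  · rcases max_choice (c₁ * u) (c₂ * v) with h | h <;> rw [h] <;> assumption

end AdvReg

theorem theorem4 (d : ℕ) (hd : 0 < d) (β C μmin μmax σ cl cu : ℝ)
    (hβ : 0 < β) (hC : 0 < C) (hμ0 : 0 < μmin) (hμ1 : μmin < 1) (hμ2 : 1 < μmax)
    (hσ : 0 < σ) (hcl : cl ∈ Set.Icc (0 : ℝ) 1) (hcu : cu ∈ Set.Icc (0 : ℝ) 1)
    (hc : 0 < cl + cu) :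
    (∀ q : ℝ, 1 ≤ q → ∃ c : ℝ, 0 < c ∧ ∃ N : ℕ, ∀ n : ℕ, N ≤ n →
      ∀ r : ℝ, ∀ A ∈ AdvReg.SODAClass d cl cu r,
        ENNReal.ofReal
            (c * (r ^ (q * min 1 β) + (n : ℝ) ^ (-(q * β) / (2 * β + (d : ℝ)))))
          ≤ AdvReg.minimaxRisk n β C μmin μmax σ q A) ∧
    (∃ c : ℝ, 0 < c ∧ ∃ N : ℕ, ∀ n : ℕ, N ≤ n →
      ∀ r : ℝ, ∀ A ∈ AdvReg.SODAClass d cl cu r,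
        ENNReal.ofReal
            (c * (r ^ (min 1 β) + ((n : ℝ) / Real.log n) ^ (-β / (2 * β + (d : ℝ)))))
          ≤ AdvReg.minimaxRiskSup n β C μmin μmax σ A) := by
  have hκ : 0 < max cl cu := by
    by_contra hneg
    have h1 := le_max_left cl cu
    have h2 := le_max_right cl cu
    linarith
  have hκ1 : max cl cu ≤ 1 := max_le hcl.2 hcu.2
  have hm : 0 < min 1 β := lt_min one_pos hβ
  constructor
  · intro q hq
    have hq0 : 0 < q := by linarith
    obtain ⟨c₁, hc₁, H₁⟩ := AdvReg.attack_lower_bound d hd hβ hC hσ hκ hκ1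
    obtain ⟨c₂, hc₂, H₂⟩ := AdvReg.nonparametric_lower_bound d hβ hC hσ
    refine ⟨min (c₁ ^ q) (c₂ ^ q) / 2, by positivity, 1, fun n hn r A hA => ?_⟩
    refine le_iInf₂ fun fhat hfhat => ?_
    set S := ⨆ (P : Measure (AdvReg.E d × ℝ)) (f : AdvReg.E d → ℝ)
      (_ : AdvReg.InClass β C μmin μmax σ P f), AdvReg.advRisk q A P fhat f with hS
    obtain ⟨hatt, u, hu, hAu⟩ := AdvReg.exists_direction hcl.1 hcu.1 hA
    have hr := hatt.nonneg
    -- Both lower bounds are applied to integrated first powers with `R = S ^ q⁻¹`; raising to the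
    -- power `q` afterwards gives the stated rates.
    have hbound : ∀ f : AdvReg.E d → ℝ, Continuous f → (∀ x, |f x| ≤ σ) →
        f ∈ AdvReg.HolderClass d β C → ∀ G : AdvReg.Sample d n → AdvReg.E d → ℝ≥0∞,
        Measurable (Function.uncurry G) → (∀ z, ∀ x ∈ AdvReg.cube d, ∃ x' ∈ A x,
          G z x ≤ ENNReal.ofReal |fhat z x' - f x|) →
        ∫⁻ z, (∫⁻ x in AdvReg.cube d, G z x)
          ∂(Measure.pi fun _ : Fin n => AdvReg.law σ f) ≤ S ^ q⁻¹ := by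
      intro f hf hfσ hfH G hG hGA
      rw [ENNReal.le_rpow_inv_iff hq0]
      exact (AdvReg.lintegral_rpow_le_advRisk hq hσ hf hfσ hG hGA).trans
        (le_iSup₂_of_le (AdvReg.law σ f) f (le_iSup_of_le
          (AdvReg.inClass_law hμ1 hμ2 hσ hf.measurable hfσ hfH) le_rfl))
    have hpow : ∀ {c v w : ℝ}, 0 < c → 0 ≤ v → ENNReal.ofReal (c * v ^ w) ≤ S ^ q⁻¹ →
        ENNReal.ofReal (c ^ q * v ^ (w * q)) ≤ S := by
      intro c v w hc hv h
      rw [ENNReal.le_rpow_inv_iff hq0, ENNReal.ofReal_rpow_of_nonneg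
        (mul_nonneg hc.le (Real.rpow_nonneg hv _)) hq0.le,
        Real.mul_rpow hc.le (Real.rpow_nonneg hv _), ← Real.rpow_mul hv] at h
      exact h
    refine AdvReg.ofReal_min_half_mul_add_le (Real.rpow_nonneg hr _)
      (Real.rpow_nonneg n.cast_nonneg _) ?_ ?_
    -- For `r = 0` the exponent is positive, so the term vanishes.
    · rcases hr.eq_or_lt with h0 | hr0
      · rw [← h0, Real.zero_rpow (by positivity)]; simp
      · rw [mul_comm q]
        exact hpow hc₁ hr (H₁ n r hr0 hatt.le_sqrt u hu A hatt.mem_self hAu fhat hfhat _ hbound)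
    · rw [show -(q * β) / (2 * β + (d : ℝ)) = -β / (2 * β + d) * q by ring]
      refine hpow hc₂ n.cast_nonneg (H₂ n hn fhat hfhat _ fun f hf hfσ hfH => ?_)
      exact hbound f hf hfσ hfH (fun z x => ENNReal.ofReal |fhat z x - f x|)
        (hfhat.sub (hf.measurable.comp measurable_snd)).abs.ennreal_ofReal
        fun z x hx => ⟨x, hatt.mem_self x hx, le_rfl⟩
  · obtain ⟨c₁, hc₁, H₁⟩ := AdvReg.attack_lower_bound_sup d hd hβ hC hσ hκ hκ1
    obtain ⟨c₂, hc₂, H₂⟩ := AdvReg.nonparametric_lower_bound_sup d hd hβ hC hσ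
    refine ⟨min c₁ c₂ / 2, by positivity, 3, fun n hn r A hA => ?_⟩
    refine le_iInf₂ fun fhat hfhat => ?_
    set S := ⨆ (P : Measure (AdvReg.E d × ℝ)) (f : AdvReg.E d → ℝ)
      (_ : AdvReg.InClass β C μmin μmax σ P f), AdvReg.advRiskSup A P fhat f with hS
    obtain ⟨hatt, u, hu, hAu⟩ := AdvReg.exists_direction hcl.1 hcu.1 hA
    have hr := hatt.nonneg
    have hbound : ∀ f : AdvReg.E d → ℝ, Continuous f → (∀ x, |f x| ≤ σ) →
        f ∈ AdvReg.HolderClass d β C → AdvReg.advRiskSup A (AdvReg.law σ f) fhat f ≤ S :=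
      fun f hf hfσ hfH => le_iSup₂_of_le (AdvReg.law σ f) f (le_iSup_of_le
        (AdvReg.inClass_law hμ1 hμ2 hσ hf.measurable hfσ hfH) le_rfl)
    refine AdvReg.ofReal_min_half_mul_add_le (Real.rpow_nonneg hr _) (Real.rpow_nonneg
      (div_nonneg n.cast_nonneg (Real.log_natCast_nonneg n)) _) ?_ ?_
    · rcases hr.eq_or_lt with h0 | hr0
      · rw [← h0, Real.zero_rpow hm.ne']; simp
      · exact H₁ n r hr0 hatt.le_sqrt u hu A hatt.mem_self hAu fhat S hbound
    · refine H₂ n hn fhat hfhat S fun f hf hfσ hfH => le_trans ?_ (hbound f hf hfσ hfH)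
      exact lintegral_mono fun z => iSup₂_mono fun x hx =>
        le_iSup₂_of_le x (hatt.mem_self x hx) le_rfl
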